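/- Let $n,d,k\ge 0$ be integers and let the symmetric group $S_n$ act on $\mathcal H=(\mathbb C^d)^{\otimes n}$ by permuting the tensor factors. Let $\mathcal H_\times$ be the compact group of all unitaries on $\mathcal H$ that commute with $g^{\otimes n}$ for every $g\in\mathrm{SU}(d)$. By Schur–Weyl duality $\mathcal H=\bigoplus_\lambda 1_{m_\lambda}\otimes S^\lambda$ with pairwise inequivalent irreducible representations $S^\lambda$ of $S_n$ occurring with multiplicity $m_\lambda$, and $\mathcal H_\times$ consists of the operators $U=\bigoplus_\lambda I_{m_\lambda}\otimes U_\lambda$ with $U_\lambda\in\mathrm U(S^\lambda)$. Let $S\mathcal H_\times\subseteq\mathcal H_\times$ be the subgroup with trivial relative phases, that is, the subgroup of those $U$ with $\det U_\lambda=1$ for all $\lambda$; equivalently, the restriction of $U$ to every irreducible $S_n$-subrepresentation of $\mathcal H$ has determinant $1$. For a compact group $G$ of unitaries on $\mathcal H$ let $$T_k^G=\int_G U^{\otimes k}\otimes\bar U^{\otimes k}\,dU$$ be its $k$-th moment operator, where $dU$ is the normalized Haar measure of $G$. Suppose that $k<n-1$, that $d<n$ if $k\ge 1$, and that $(n,k)\neq(4,2)$.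 Then $S\mathcal H_\times$ is an $\mathrm{SU}(d)$-symmetric exact $k$-design: $$T_k^{S\mathcal H_\times}=T_k^{\mathcal H_\times}.$$ -/

import Mathlib

open scoped Kronecker ComplexConjugate

noncomputable section

namespace SymDesign

/-- The `n`-th tensor power `A ⊗ ⋯ ⊗ A` of a matrix `A`, in the product basis
`|x₁, …, xₙ⟩`, `x : Fin n → ι`. -/
def tensorPower {ι : Type*} (n : ℕ) (A : Matrix ι ι ℂ) :
    Matrix (Fin n → ι) (Fin n → ι) ℂ :=
  Matrix.of fun x y => ∏ i, A (x i) (y i)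

/-! ### The group of `SU(d)`-symmetric unitaries -/

/-- The labels of the computational basis of the `n`-qudit space `(ℂ^d)^{⊗ n}`; the space itself
is `Config n d → ℂ`. -/
abbrev Config (n d : ℕ) : Type := Fin n → Fin d

/-- The group of unitaries on `(ℂ^d)^{⊗ n}` which commute with `g^{⊗ n}` for every `g ∈ SU(d)`. -/
def symmetricUnitaries (n d : ℕ) : Subgroup (Matrix.unitaryGroup (Config n d) ℂ) where
  carrier := {U | ∀ g ∈ Matrix.specialUnitaryGroup (Fin d) ℂ,
    Commute (U : Matrix (Config n d) (Config n d) ℂ) (tensorPower n g)}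
  mul_mem' hU hV g hg := (hU g hg).mul_left (hV g hg)
  one_mem' g _ := Commute.one_left _
  inv_mem' := by
    intro U hU g hg
    have h := hU g hg
    have h1 : (U : Matrix (Config n d) (Config n d) ℂ) * ((U⁻¹ : Matrix.unitaryGroup _ ℂ) :
        Matrix (Config n d) (Config n d) ℂ) = 1 := by
      rw [← Submonoid.coe_mul, mul_inv_cancel, Submonoid.coe_one]
    have h2 : ((U⁻¹ : Matrix.unitaryGroup _ ℂ) : Matrix (Config n d) (Config n d) ℂ) *
        (U : Matrix (Config n d) (Config n d) ℂ) = 1 := by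
      rw [← Submonoid.coe_mul, inv_mul_cancel, Submonoid.coe_one]
    exact Commute.units_inv_left (u := ⟨_, _, h1, h2⟩) h

/-! ### The action of `S_n` and the subgroup with trivial relative phases -/

/-- The action of `S_n` on `(ℂ^d)^{⊗ n}` by permutation of the qudits; on basis vectors,
`σ |x₁, …, xₙ⟩ = |x_{σ⁻¹(1)}, …, x_{σ⁻¹(n)}⟩`. -/
def permRep (n d : ℕ) : Representation ℂ (Equiv.Perm (Fin n)) (Config n d → ℂ) where
  toFun σ := LinearMap.funLeft ℂ ℂ fun x : Config n d => x ∘ σ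
  map_one' := by ext; rfl
  map_mul' _ _ := by ext; rfl

/-- `U` preserves the subspace `W`, and its restriction to `W` has determinant `1`. -/
def HasDetOneOn {ι : Type*} [Fintype ι] [DecidableEq ι] (W : Submodule ℂ (ι → ℂ))
    (U : Matrix ι ι ℂ) : Prop :=
  ∃ h : ∀ v ∈ W, Matrix.toLin' U v ∈ W, LinearMap.det ((Matrix.toLin' U).restrict h) = 1

section HasDetOneOn

variable {ι : Type*} [Fintype ι] [DecidableEq ι] {W : Submodule ℂ (ι → ℂ)}

theorem HasDetOneOn.one : HasDetOneOn W (1 : Matrix ι ι ℂ) := by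
  refine ⟨fun v hv => by simpa using hv, ?_⟩
  have : (Matrix.toLin' (1 : Matrix ι ι ℂ)).restrict
      (fun v hv => by simpa using hv : ∀ v ∈ W, Matrix.toLin' (1 : Matrix ι ι ℂ) v ∈ W) =
      LinearMap.id := by
    ext; simp
  rw [this, LinearMap.det_id]

theorem HasDetOneOn.mul {U V : Matrix ι ι ℂ} (hU : HasDetOneOn W U) (hV : HasDetOneOn W V) :
    HasDetOneOn W (U * V) := by
  obtain ⟨hU, dU⟩ := hU
  obtain ⟨hV, dV⟩ := hV
  have h : ∀ v ∈ W, Matrix.toLin' (U * V) v ∈ W := fun v hv => by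
    rw [Matrix.toLin'_mul]; exact hU _ (hV _ hv)
  refine ⟨h, ?_⟩
  have : (Matrix.toLin' (U * V)).restrict h =
      (Matrix.toLin' U).restrict hU ∘ₗ (Matrix.toLin' V).restrict hV := by
    ext; simp [Matrix.toLin'_mul]
  rw [this, LinearMap.det_comp, dU, dV, one_mul]

theorem HasDetOneOn.inv {U V : Matrix ι ι ℂ} (hUV : U * V = 1) (hU : HasDetOneOn W U) :
    HasDetOneOn W V := by
  obtain ⟨hU, dU⟩ := hU
  have hVU : V * U = 1 := mul_eq_one_comm.mp hUV
  have hsurj : Function.Surjective ((Matrix.toLin' U).restrict hU) :=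
    ((LinearMap.isUnit_iff_range_eq_top _).mp
      ((LinearMap.isUnit_iff_isUnit_det _).mpr (by rw [dU]; exact isUnit_one))) |>
      LinearMap.range_eq_top.mp
  have h : ∀ v ∈ W, Matrix.toLin' V v ∈ W := by
    intro v hv
    obtain ⟨w, hw⟩ := hsurj ⟨v, hv⟩
    have hw' : Matrix.toLin' U w = v := congrArg Subtype.val hw
    rw [← hw', ← LinearMap.comp_apply, ← Matrix.toLin'_mul, hVU]
    simp
  refine ⟨h, ?_⟩
  have : (Matrix.toLin' U).restrict hU ∘ₗ (Matrix.toLin' V).restrict h = LinearMap.id := by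
    ext v : 2
    change Matrix.toLin' U (Matrix.toLin' V v) = v
    rw [← LinearMap.comp_apply, ← Matrix.toLin'_mul, hUV]
    simp
  have := congrArg LinearMap.det this
  rwa [LinearMap.det_comp, dU, one_mul, LinearMap.det_id] at this

end HasDetOneOn

/-- The group of `SU(d)`-symmetric unitaries with trivial relative phases. In the decomposition
`(ℂ^d)^{⊗ n} = ⨁_λ 1_{m_λ} ⊗ S^λ` into irreducible representations of `S_n`, the irreducible
subrepresentations are the copies `v ⊗ S^λ` of the sectors `S^λ`, and a symmetric unitary
`U = ⨁_λ 1 ⊗ U_λ` restricts to `U_λ` on each of them; the group is therefore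
`{⨁_λ 1 ⊗ U_λ | U_λ ∈ SU(S^λ) for all λ}`. -/
def specialSymmetricUnitaries (n d : ℕ) : Subgroup (Matrix.unitaryGroup (Config n d) ℂ) where
  carrier := {U | U ∈ symmetricUnitaries n d ∧
    ∀ W : Subrepresentation (permRep n d), W.toRepresentation.IsIrreducible →
      HasDetOneOn W.toSubmodule (U : Matrix (Config n d) (Config n d) ℂ)}
  mul_mem' hU hV := ⟨mul_mem hU.1 hV.1, fun W hW => (hU.2 W hW).mul (hV.2 W hW)⟩
  one_mem' := ⟨one_mem _, fun _ _ => HasDetOneOn.one⟩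
  inv_mem' {U} hU := ⟨inv_mem hU.1, fun W hW => (hU.2 W hW).inv (by
    rw [← Submonoid.coe_mul, mul_inv_cancel, Submonoid.coe_one])⟩

/-! ### Compactness -/

instance compactSpace_unitaryGroup {ι : Type*} [Fintype ι] [DecidableEq ι] :
    CompactSpace (Matrix.unitaryGroup ι ℂ) := by
  have hK : IsCompact {A : ι → ι → ℂ | ∀ i j, A i j ∈ Metric.closedBall (0 : ℂ) 1} := by
    have := isCompact_univ_pi (ι := ι) (X := fun _ => ι → ℂ)
      (s := fun _ => {a | ∀ j, a j ∈ Metric.closedBall (0 : ℂ) 1}) fun _ => by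
        have := isCompact_univ_pi (ι := ι) (X := fun _ => ℂ)
          (s := fun _ => Metric.closedBall (0 : ℂ) 1) fun _ => isCompact_closedBall 0 1
        simpa [Set.pi] using this
    simpa [Set.pi] using this
  have hcl : IsClosed (Matrix.unitaryGroup ι ℂ : Set (Matrix ι ι ℂ)) :=
    isClosed_unitary
  exact isCompact_iff_compactSpace.mp <| hK.of_isClosed_subset hcl fun U hU i j => by
    simpa using entry_norm_bound_of_unitary hU i j

theorem isClosed_symmetricUnitaries (n d : ℕ) :
    IsClosed (symmetricUnitaries n d : Set (Matrix.unitaryGroup (Config n d) ℂ)) := by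
  have : (symmetricUnitaries n d : Set (Matrix.unitaryGroup (Config n d) ℂ)) =
      ⋂ g ∈ Matrix.specialUnitaryGroup (Fin d) ℂ, {U : Matrix.unitaryGroup (Config n d) ℂ |
        (U : Matrix (Config n d) (Config n d) ℂ) * tensorPower n g = tensorPower n g * U} := by
    ext U
    simp only [Set.mem_iInter]
    rfl
  rw [this]
  exact isClosed_biInter fun g _ => isClosed_eq
    (continuous_subtype_val.mul continuous_const) (continuous_const.mul continuous_subtype_val)

theorem isClosed_hasDetOneOn {ι : Type*} [Fintype ι] [DecidableEq ι]
    (W : Submodule ℂ (ι → ℂ)) : IsClosed {U : Matrix ι ι ℂ | HasDetOneOn W U} := by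
  obtain ⟨p, hp⟩ := W.subtype.exists_leftInverse_of_injective (Submodule.ker_subtype W)
  let b := Module.finBasis ℂ W
  let c : Matrix ι ι ℂ →ₗ[ℂ] Matrix _ _ ℂ :=
    (LinearMap.toMatrix b b).toLinearMap ∘ₗ LinearMap.llcomp ℂ W (ι → ℂ) W p ∘ₗ
      LinearMap.lcomp ℂ (ι → ℂ) W.subtype ∘ₗ (Matrix.toLin' (R := ℂ)).toLinearMap
  have hc : Continuous c := c.continuous_of_finiteDimensional
  have key : ∀ (U : Matrix ι ι ℂ) (h : ∀ v ∈ W, Matrix.toLin' U v ∈ W),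
      LinearMap.det ((Matrix.toLin' U).restrict h) = (c U).det := by
    intro U h
    rw [← LinearMap.det_toMatrix b]
    have hr : (Matrix.toLin' U).restrict h = p ∘ₗ Matrix.toLin' U ∘ₗ W.subtype :=
      LinearMap.ext fun v => (LinearMap.congr_fun hp ((Matrix.toLin' U).restrict h v)).symm
    rw [hr]
    rfl
  have : {U : Matrix ι ι ℂ | HasDetOneOn W U} =
      (⋂ v ∈ W, {U : Matrix ι ι ℂ | Matrix.toLin' U v ∈ W}) ∩ {U | (c U).det = 1} := by
    ext U
    simp only [Set.mem_inter_iff, Set.mem_iInter, Set.mem_ofPred_eq]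
    constructor
    · rintro ⟨h, hd⟩
      exact ⟨h, (key U h).symm.trans hd⟩
    · rintro ⟨h, hd⟩
      exact ⟨h, (key U h).trans hd⟩
  rw [this]
  refine IsClosed.inter (isClosed_biInter fun v _ => ?_)
    (isClosed_eq hc.matrix_det continuous_const)
  exact W.closed_of_finiteDimensional.preimage
    (((LinearMap.applyₗ v : ((ι → ℂ) →ₗ[ℂ] (ι → ℂ)) →ₗ[ℂ] (ι → ℂ)) ∘ₗ
      (Matrix.toLin' (R := ℂ)).toLinearMap).continuous_of_finiteDimensional)

theorem isClosed_specialSymmetricUnitaries (n d : ℕ) :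
    IsClosed (specialSymmetricUnitaries n d : Set (Matrix.unitaryGroup (Config n d) ℂ)) := by
  have : (specialSymmetricUnitaries n d : Set (Matrix.unitaryGroup (Config n d) ℂ)) =
      (symmetricUnitaries n d : Set (Matrix.unitaryGroup (Config n d) ℂ)) ∩
      ⋂ (W : Subrepresentation (permRep n d)) (_ : W.toRepresentation.IsIrreducible),
        Subtype.val ⁻¹' {U : Matrix (Config n d) (Config n d) ℂ |
          HasDetOneOn W.toSubmodule U} := by
    ext U
    simp only [Set.mem_inter_iff, Set.mem_iInter]
    rfl
  rw [this]
  exact (isClosed_symmetricUnitaries n d).inter <| isClosed_iInter fun W => isClosed_iInter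
    fun _ => (isClosed_hasDetOneOn _).preimage continuous_subtype_val

instance compactSpace_symmetricUnitaries (n d : ℕ) : CompactSpace (symmetricUnitaries n d) :=
  isCompact_iff_compactSpace.mp (isClosed_symmetricUnitaries n d).isCompact

instance compactSpace_specialSymmetricUnitaries (n d : ℕ) :
    CompactSpace (specialSymmetricUnitaries n d) :=
  isCompact_iff_compactSpace.mp (isClosed_specialSymmetricUnitaries n d).isCompact

/-! ### Moment operators -/

/-- Subgroups of the unitary group carry their Borel σ-algebra. -/
instance measurableSpace_subgroup {ι : Type*} [Fintype ι] [DecidableEq ι]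
    (G : Subgroup (Matrix.unitaryGroup ι ℂ)) : MeasurableSpace G := borel G

instance borelSpace_subgroup {ι : Type*} [Fintype ι] [DecidableEq ι]
    (G : Subgroup (Matrix.unitaryGroup ι ℂ)) : BorelSpace G := ⟨rfl⟩

/-- The Haar measure of a compact group of unitaries, normalized to total mass `1`. -/
def haarProb {ι : Type*} [Fintype ι] [DecidableEq ι]
    (G : Subgroup (Matrix.unitaryGroup ι ℂ)) [CompactSpace G] : MeasureTheory.Measure G :=
  MeasureTheory.Measure.haarMeasure ⊤

/-- The `k`-th moment operator `T_k^G = ∫_G U^{⊗ k} ⊗ Ū^{⊗ k} dU` of a compact group `G` of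
unitaries, where `dU` is the normalized Haar measure of `G` and `Ū` is the entrywise complex
conjugate of `U`. The integral is taken entry by entry. -/
def momentOperator {ι : Type*} [Fintype ι] [DecidableEq ι] (k : ℕ)
    (G : Subgroup (Matrix.unitaryGroup ι ℂ)) [CompactSpace G] :
    Matrix ((Fin k → ι) × (Fin k → ι)) ((Fin k → ι) × (Fin k → ι)) ℂ :=
  Matrix.of fun a b => ∫ U : G,
    (tensorPower k (U : Matrix ι ι ℂ) ⊗ₖ tensorPower k ((U : Matrix ι ι ℂ).map conj)) a b
      ∂(haarProb G)

end SymDesign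

end

/-!
Write `H` for the special symmetric unitaries and `G` for all symmetric unitaries. If the moment
operator `T` of `H` satisfies `T * (V^{⊗ k} ⊗ V̄^{⊗ k}) = T` for every `V ∈ G`, then averaging over
`G`, respectively over `H`, shows that `T` is the moment operator of `G`.

By Schur–Weyl duality, `G` consists of the unitaries in the bicommutant of the action of `S_n`.
Choosing a root of each of its sector determinants, one can correct an element of `G` by phases
`ζ λ` on the isotypic components to obtain an element of `H`, so it suffices to consider these
phases. In an orthonormal basis adapted to the isotypic components, `ζ` multiplies the entries of
`T` by characters evaluated at two words of length `k` in the labels `λ`. The phases with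
`ζ λ ^ dim S^λ = 1` belong to `H`, so at a nonzero entry the two words have the same value under
each of them. Hence every label with `dim S^λ > k` occurs equally often in both words, and if there
is at most one further label, then so does this label, because the words have the same length. Thus
no phase `ζ` changes `T`.

It remains to see that at most one sector has dimension at most `k`. If all transpositions act on a
representation by the same operator, and it occurs in `(ℂ^d)^{⊗ n}` with `d < n`, then it is
trivial, because every configuration has a repeated letter and is fixed by some transposition. This
applies in dimension at most `1`, and also for `n ≥ 5` in dimension at most `n - 2`, where the proof
is by induction in steps of two. If both eigenspaces of a transposition have dimension at least `2`,
they are small representations of `S_{n-2}`. Otherwise, after a twist by the sign character, either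
the transposition acts trivially or it is a reflection in a vector `v`; unless the transpositions
agree, the images of `v` behave like the roots `e_i - e_j` and span a space of dimension `n - 1`.
-/

noncomputable section

namespace SymDesign

open MeasureTheory Matrix

/-! ### Moments and words -/

section TensorPower

variable {ι : Type*} (n : ℕ)

theorem tensorPower_mul [Fintype ι] (A B : Matrix ι ι ℂ) :
    tensorPower n (A * B) = tensorPower n A * tensorPower n B := by
  ext x y
  simp only [tensorPower, of_apply, mul_apply, Finset.prod_univ_sum, Fintype.piFinset_univ,
    Finset.prod_mul_distrib]

theorem tensorPower_diagonal [DecidableEq ι] (t : ι → ℂ) :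
    tensorPower n (diagonal t) = diagonal fun x => ∏ i, t (x i) := by
  ext x y
  simp only [tensorPower, of_apply, diagonal_apply, funext_iff]
  rw [Finset.prod_ite_zero]
  simp only [Finset.mem_univ, true_imp_iff]

theorem tensorPower_smul (c : ℂ) (A : Matrix ι ι ℂ) :
    tensorPower n (c • A) = c ^ n • tensorPower n A := by
  ext x y
  simp [tensorPower, Finset.prod_mul_distrib]

end TensorPower

section Moments

variable {ι : Type*} (k : ℕ)

/-- The integrand `U^{⊗ k} ⊗ Ū^{⊗ k}` of the moment operator. -/
def momentMatrix (U : Matrix ι ι ℂ) :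
    Matrix ((Fin k → ι) × (Fin k → ι)) ((Fin k → ι) × (Fin k → ι)) ℂ :=
  tensorPower k U ⊗ₖ tensorPower k (U.map conj)

theorem momentMatrix_diagonal [DecidableEq ι] (c : ι → ℂ) :
    momentMatrix k (diagonal c) =
      diagonal fun x => (∏ i, c (x.1 i)) * ∏ i, conj (c (x.2 i)) := by
  rw [momentMatrix, diagonal_map (map_zero _), tensorPower_diagonal, tensorPower_diagonal,
    diagonal_kronecker_diagonal]

theorem momentMatrix_one [DecidableEq ι] : momentMatrix k (1 : Matrix ι ι ℂ) = 1 := by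
  rw [← diagonal_one, momentMatrix_diagonal]
  simp

variable [Fintype ι]

theorem momentMatrix_mul (U V : Matrix ι ι ℂ) :
    momentMatrix k (U * V) = momentMatrix k U * momentMatrix k V := by
  rw [momentMatrix, momentMatrix, momentMatrix, Matrix.map_mul, tensorPower_mul, tensorPower_mul,
    mul_kronecker_mul]

theorem mul_momentMatrix_diagonal_eq_self_iff [DecidableEq ι] {α : Type*} (c : ι → Circle)
    (R : Matrix α ((Fin k → ι) × (Fin k → ι)) ℂ) :
    R * momentMatrix k (diagonal fun i => (c i : ℂ)) = R ↔
      ∀ a x y, R a (x, y) ≠ 0 → ∏ i, c (x i) = ∏ i, c (y i) := by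
  have hcoe (x : Fin k → ι) : ∏ i, (c (x i) : ℂ) = (∏ i, c (x i) : Circle) :=
    (map_prod Circle.coeHom _ _).symm
  have hweight (x y : Fin k → ι) :
      (∏ i, (c (x i) : ℂ)) * ∏ i, conj (c (y i) : ℂ) = 1 ↔ ∏ i, c (x i) = ∏ i, c (y i) := by
    rw [← map_prod, hcoe, hcoe, ← Circle.coe_inv_eq_conj, ← Circle.coe_mul, Circle.coe_eq_one,
      mul_inv_eq_one]
  simp only [momentMatrix_diagonal, ← Matrix.ext_iff, mul_diagonal, Prod.forall, ← hweight]
  exact forall₃_congr fun a x y =>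
    ⟨fun h h0 => mul_left_cancel₀ h0 (h.trans (mul_one _).symm), fun h => by
      by_cases h0 : R a (x, y) = 0
      · rw [h0, zero_mul]
      · rw [h h0, mul_one]⟩

variable [DecidableEq ι] (G : Subgroup (unitaryGroup ι ℂ)) [CompactSpace G]

instance isHaarMeasure_haarProb : (haarProb G).IsHaarMeasure :=
  Measure.isHaarMeasure_haarMeasure _

instance isProbabilityMeasure_haarProb : IsProbabilityMeasure (haarProb G) :=
  ⟨Measure.haarMeasure_self⟩

instance isMulRightInvariant_haarProb : (haarProb G).IsMulRightInvariant where
  map_mul_right_eq_self g :=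
    have := Measure.isProbabilityMeasure_map (μ := haarProb G)
      (measurable_mul_const g).aemeasurable
    Measure.isHaarMeasure_eq_of_isProbabilityMeasure _ _

theorem momentOperator_apply (a b) :
    momentOperator k G a b = ∫ U : G, momentMatrix k (U : Matrix ι ι ℂ) a b ∂(haarProb G) := rfl

theorem integrable_momentMatrix (a b) :
    Integrable (fun U : G => momentMatrix k (U : Matrix ι ι ℂ) a b) (haarProb G) := by
  have hentry (i j) : Continuous fun U : G => (U : Matrix ι ι ℂ) i j :=
    (continuous_subtype_val.comp continuous_subtype_val).matrix_elem i j
  have hcont : Continuous fun U : G => momentMatrix k (U : Matrix ι ι ℂ) a b := by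
    simp only [momentMatrix, kroneckerMap_apply, tensorPower, of_apply, map_apply]
    exact (continuous_finsetProd _ fun _ _ => hentry _ _).mul
      (continuous_finsetProd _ fun _ _ => Complex.continuous_conj.comp (hentry _ _))
  exact hcont.integrable_of_hasCompactSupport (HasCompactSupport.of_compactSpace _)

theorem mul_momentOperator_apply {α : Type*} (A : Matrix α ((Fin k → ι) × (Fin k → ι)) ℂ) (a b) :
    (A * momentOperator k G) a b =
      ∫ U : G, (A * momentMatrix k (U : Matrix ι ι ℂ)) a b ∂(haarProb G) := by
  simp only [mul_apply, momentOperator_apply]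
  rw [integral_finsetSum _ fun c _ => (integrable_momentMatrix k G c b).const_mul (A a c)]
  exact Finset.sum_congr rfl fun c _ => (integral_const_mul _ _).symm

theorem momentOperator_mul_apply {α : Type*} (A : Matrix ((Fin k → ι) × (Fin k → ι)) α ℂ) (a b) :
    (momentOperator k G * A) a b =
      ∫ U : G, (momentMatrix k (U : Matrix ι ι ℂ) * A) a b ∂(haarProb G) := by
  simp only [mul_apply, momentOperator_apply]
  rw [integral_finsetSum _ fun c _ => (integrable_momentMatrix k G a c).mul_const (A c b)]
  exact Finset.sum_congr rfl fun c _ => (integral_mul_const _ _).symm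

variable {G}

theorem momentOperator_mul_momentMatrix {V : unitaryGroup ι ℂ} (hV : V ∈ G) :
    momentOperator k G * momentMatrix k (V : Matrix ι ι ℂ) = momentOperator k G := by
  ext a b
  simp only [momentOperator_mul_apply, momentOperator_apply, ← momentMatrix_mul]
  exact integral_mul_right_eq_self
    (fun U : G => momentMatrix k (U : Matrix ι ι ℂ) a b) ⟨V, hV⟩

theorem momentMatrix_mul_momentOperator {V : unitaryGroup ι ℂ} (hV : V ∈ G) :
    momentMatrix k (V : Matrix ι ι ℂ) * momentOperator k G = momentOperator k G := by
  ext a b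
  simp only [mul_momentOperator_apply, momentOperator_apply, ← momentMatrix_mul]
  exact integral_mul_left_eq_self
    (fun U : G => momentMatrix k (U : Matrix ι ι ℂ) a b) ⟨V, hV⟩

theorem momentOperator_eq_of_le {H : Subgroup (unitaryGroup ι ℂ)} [CompactSpace H] (hle : H ≤ G)
    (hinv : ∀ V ∈ G, momentOperator k H * momentMatrix k (V : Matrix ι ι ℂ) = momentOperator k H) :
    momentOperator k H = momentOperator k G := by
  calc momentOperator k H = momentOperator k H * momentOperator k G := by
        ext a b
        rw [mul_momentOperator_apply]
        simp [fun U : G => hinv U U.2]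
    _ = momentOperator k G := by
        ext a b
        rw [momentOperator_mul_apply]
        simp [fun U : H => momentMatrix_mul_momentOperator k (hle U.2)]

end Moments

section Words

variable {α Λ : Type*} [Fintype α]

theorem exists_perm_comp_eq_of_map_univ_eq {f g : α → Λ}
    (h : Finset.univ.val.map f = Finset.univ.val.map g) : ∃ σ : Equiv.Perm α, g ∘ σ = f := by
  classical
  have hfiber (l : Λ) : Nonempty ({a // f a = l} ≃ {a // g a = l}) := by
    refine ⟨Fintype.equivOfCardEq ?_⟩
    have hcount := congrArg (Multiset.count l) h
    simpa only [Multiset.count_map, Fintype.card_subtype, Finset.card_def, Finset.filter_val,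
      eq_comm] using hcount
  exact ⟨Equiv.ofFiberEquiv fun l => (hfiber l).some, funext fun a => Equiv.ofFiberEquiv_map _ a⟩

theorem prod_eq_prod_of_map_univ_eq {M : Type*} [CommMonoid M] {f g : α → Λ}
    (h : Finset.univ.val.map f = Finset.univ.val.map g) (ζ : Λ → M) :
    ∏ a, ζ (f a) = ∏ a, ζ (g a) := by
  have hprod := congrArg (fun s => (s.map ζ).prod) h
  simpa only [Multiset.map_map, Function.comp_def, Finset.prod_eq_multiset_prod] using hprod

theorem prod_mulSingle_apply {M : Type*} [CommMonoid M] [DecidableEq Λ] (f : α → Λ) (l : Λ)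
    (ω : M) :
    ∏ a, Pi.mulSingle (M := fun _ => M) l ω (f a) =
      ω ^ (Finset.univ.val.map f).count l := by
  simp only [Pi.mulSingle_apply, Finset.prod_ite, Finset.prod_const, one_pow, mul_one,
    Multiset.count_map, Finset.card_def, Finset.filter_val, eq_comm]

theorem multiset_eq_of_forall_ne_count_eq [DecidableEq Λ] {s t : Multiset Λ} (l₀ : Λ)
    (hcard : s.card = t.card) (h : ∀ l, l ≠ l₀ → s.count l = t.count l) : s = t := by
  have hdecomp (s : Multiset Λ) : Multiset.replicate (s.count l₀) l₀ + s.filter (· ≠ l₀) = s := by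
    rw [← Multiset.filter_eq', Multiset.filter_add_not]
  have hfilter : s.filter (· ≠ l₀) = t.filter (· ≠ l₀) := by
    ext l
    by_cases hl : l = l₀
    · simp [hl]
    · simpa only [Multiset.count_filter, ne_eq, hl, not_false_eq_true, if_true] using h l hl
  rw [← hdecomp s, ← hdecomp t, hfilter, Multiset.card_add, Multiset.card_add,
    Multiset.card_replicate, Multiset.card_replicate, Nat.add_right_cancel_iff] at hcard
  rw [← hdecomp s, ← hdecomp t, hfilter, hcard]

theorem exists_circle_isPrimitiveRoot {r : ℕ} (hr : r ≠ 0) :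
    ∃ ω : Circle, IsPrimitiveRoot ω r := by
  refine ⟨Circle.exp (2 * Real.pi / r), .of_map_of_injective (f := Circle.coeHom) ?_
    Circle.coe_injective⟩
  convert Complex.isPrimitiveRoot_exp r hr using 1
  change Complex.exp _ = _
  congr 1
  push_cast
  ring

theorem exists_circle_pow_eq {n : ℕ} (hn : n ≠ 0) (w : Circle) : ∃ z : Circle, z ^ n = w := by
  refine ⟨Circle.exp (Complex.arg w / n), ?_⟩
  rw [← Circle.exp_natCast_mul, mul_div_cancel₀ _ (Nat.cast_ne_zero.mpr hn), Circle.exp_arg]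

/-- A word is determined up to order by its values on the characters `ζ` with `ζ l ^ r l = 1`,
as long as at most one letter has `r l` at most the length of the word. -/
theorem map_univ_eq_of_forall_prod_eq (r : Λ → ℕ) (hr : ∀ l, r l ≠ 0)
    (hsub : {l | r l ≤ Fintype.card α}.Subsingleton) {f g : α → Λ}
    (h : ∀ ζ : Λ → Circle, (∀ l, ζ l ^ r l = 1) → ∏ a, ζ (f a) = ∏ a, ζ (g a)) :
    Finset.univ.val.map f = Finset.univ.val.map g := by
  classical
  have hcount (l) (hl : Fintype.card α < r l) :
      (Finset.univ.val.map f).count l = (Finset.univ.val.map g).count l := by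
    obtain ⟨ω, hω⟩ := exists_circle_isPrimitiveRoot (hr l)
    have hlt (f : α → Λ) : (Finset.univ.val.map f).count l < r l :=
      (Multiset.count_le_card _ _).trans_lt (by simpa using hl)
    refine hω.pow_inj (hlt f) (hlt g) ?_
    rw [← prod_mulSingle_apply, ← prod_mulSingle_apply]
    refine h _ fun m => ?_
    obtain rfl | hm := eq_or_ne m l
    · rw [Pi.mulSingle_eq_same, hω.pow_eq_one]
    · rw [Pi.mulSingle_eq_of_ne hm, one_pow]
  obtain hempty | ⟨l₀, hl₀⟩ := hsub.eq_empty_or_singleton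
  · ext l
    exact hcount l (not_le.mp fun hl => (hempty ▸ hl : l ∈ (∅ : Set Λ)))
  · refine multiset_eq_of_forall_ne_count_eq l₀ (by simp) fun l hl =>
      hcount l (not_le.mp fun h => ?_)
    exact hl (hl₀ ▸ h : l ∈ ({l₀} : Set Λ))

end Words

/-! ### Sectors and phases of a self-adjoint action -/

section Determinants

variable {ι : Type*} [Fintype ι] [DecidableEq ι] {W : Submodule ℂ (ι → ℂ)} {U V : Matrix ι ι ℂ}

/-- `U` preserves the subspace `W`, and its restriction to `W` has determinant `δ`; for `δ = 1`
this is `HasDetOneOn`. -/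
def HasDetOn (W : Submodule ℂ (ι → ℂ)) (U : Matrix ι ι ℂ) (δ : ℂ) : Prop :=
  ∃ h : ∀ v ∈ W, toLin' U v ∈ W, LinearMap.det ((toLin' U).restrict h) = δ

theorem HasDetOn.mul {a b : ℂ} (hU : HasDetOn W U a) (hV : HasDetOn W V b) :
    HasDetOn W (U * V) (a * b) := by
  obtain ⟨hU, rfl⟩ := hU
  obtain ⟨hV, rfl⟩ := hV
  refine ⟨fun v hv => by simpa only [toLin'_mul_apply] using hU _ (hV _ hv), ?_⟩
  rw [← LinearMap.det_comp]
  congr 1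
  ext v : 2
  exact toLin'_mul_apply U V v

theorem hasDetOn_of_mulVec_eq_smul {c : ℂ} (h : ∀ v ∈ W, U *ᵥ v = c • v) :
    HasDetOn W U (c ^ Module.finrank ℂ W) := by
  refine ⟨fun v hv => by simpa only [toLin'_apply, h v hv] using W.smul_mem c hv, ?_⟩
  have hsmul : (toLin' U).restrict (fun v hv => by
      simpa only [toLin'_apply, h v hv] using W.smul_mem c hv) = c • (LinearMap.id : W →ₗ[ℂ] W) :=
    LinearMap.ext fun v => Subtype.ext (h v v.2)
  rw [hsmul, LinearMap.det_smul, LinearMap.det_id, mul_one]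

theorem norm_toLp_mulVec (hU : U ∈ unitaryGroup ι ℂ) (v : ι → ℂ) :
    ‖WithLp.toLp 2 (U *ᵥ v)‖ = ‖WithLp.toLp 2 v‖ := by
  rw [← sq_eq_sq₀ (norm_nonneg _) (norm_nonneg _), ← Complex.ofReal_inj]
  push_cast
  simp only [← RCLike.ofReal_eq_complex_ofReal]
  rw [← inner_self_eq_norm_sq_to_K (𝕜 := ℂ), ← inner_self_eq_norm_sq_to_K (𝕜 := ℂ),
    EuclideanSpace.inner_eq_star_dotProduct, EuclideanSpace.inner_eq_star_dotProduct,
    star_mulVec, dotProduct_comm, ← dotProduct_mulVec, mulVec_mulVec, ← star_eq_conjTranspose,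
    mem_unitaryGroup_iff'.mp hU, one_mulVec, dotProduct_comm]

theorem norm_det_eq_one_of_norm_map {E : Type*} [NormedAddCommGroup E] [InnerProductSpace ℂ E]
    [FiniteDimensional ℂ E] (T : E →ₗ[ℂ] E) (hT : ∀ x, ‖T x‖ = ‖x‖) : ‖LinearMap.det T‖ = 1 := by
  rw [← LinearMap.normDet_eq_norm_det]
  exact LinearIsometry.normDet_eq_one ⟨T, hT⟩

theorem HasDetOn.norm_eq_one {δ : ℂ} (hU : U ∈ unitaryGroup ι ℂ) (h : HasDetOn W U δ) :
    ‖δ‖ = 1 := by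
  obtain ⟨hW, rfl⟩ := h
  let toLp : (ι → ℂ) ≃ₗ[ℂ] EuclideanSpace ℂ ι := (WithLp.linearEquiv 2 ℂ (ι → ℂ)).symm
  let W' : Submodule ℂ (EuclideanSpace ℂ ι) := W.map toLp.toLinearMap
  let e : W ≃ₗ[ℂ] W' := toLp.submoduleMap W
  rw [← LinearMap.det_conj _ e]
  refine norm_det_eq_one_of_norm_map (E := W') _ fun x => ?_
  obtain ⟨w, rfl⟩ := e.surjective x
  rw [LinearMap.comp_apply, LinearMap.comp_apply, LinearEquiv.coe_coe, LinearEquiv.coe_coe,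
    LinearEquiv.symm_apply_apply]
  exact norm_toLp_mulVec hU (w : ι → ℂ)

end Determinants

section Bicommutant

variable {ι : Type*} [Fintype ι] (R : Type*) [Ring R] [Module R (ι → ℂ)]

/-- `U` lies in the bicommutant of the action of `R` on `ι → ℂ`: it commutes with every `R`-linear
endomorphism. -/
def MemBicommutant (U : Matrix ι ι ℂ) : Prop :=
  ∀ (f : Module.End R (ι → ℂ)) (v : ι → ℂ), U *ᵥ f v = f (U *ᵥ v)

/-- The operators by which `R` acts on `ι → ℂ` are closed under adjoints. -/
def IsSelfAdjointAction : Prop :=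
  ∀ r : R, ∃ r' : R, ∀ v w : ι → ℂ, star v ⬝ᵥ (r • w) = star (r' • v) ⬝ᵥ w

variable {R} {U V : Matrix ι ι ℂ}

theorem MemBicommutant.mul (hU : MemBicommutant R U) (hV : MemBicommutant R V) :
    MemBicommutant R (U * V) := fun f v => by
  rw [← mulVec_mulVec, hV, hU, mulVec_mulVec]

section Semisimple

variable [IsSemisimpleModule R (ι → ℂ)]

theorem MemBicommutant.mulVec_mem (hU : MemBicommutant R U) (W : Submodule R (ι → ℂ))
    {v : ι → ℂ} (hv : v ∈ W) : U *ᵥ v ∈ W := by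
  obtain ⟨W', hW'⟩ := exists_isCompl W
  have hproj := hU (W.projection W' hW') v
  rw [Submodule.projection_apply_left hW' ⟨v, hv⟩] at hproj
  exact hproj ▸ Submodule.projection_apply_mem hW' _

variable [Algebra ℂ R] [IsScalarTower ℂ R (ι → ℂ)] [DecidableEq ι]

theorem MemBicommutant.exists_hasDetOn (hU : MemBicommutant R U) (W : Submodule R (ι → ℂ)) :
    ∃ δ, HasDetOn (W.restrictScalars ℂ) U δ :=
  ⟨_, fun _ hv => hU.mulVec_mem W hv, rfl⟩

theorem MemBicommutant.hasDetOn_of_linearEquiv (hU : MemBicommutant R U)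
    {W W' : Submodule R (ι → ℂ)} (e : W ≃ₗ[R] W') {δ : ℂ}
    (h : HasDetOn (W.restrictScalars ℂ) U δ) : HasDetOn (W'.restrictScalars ℂ) U δ := by
  obtain ⟨hW, rfl⟩ := h
  obtain ⟨f, hf⟩ := IsSemisimpleModule.extension_property W.subtype W.injective_subtype
    (W'.subtype ∘ₗ e.toLinearMap)
  have hfe (w : W) : f w = e w := LinearMap.congr_fun hf w
  let e' : W.restrictScalars ℂ ≃ₗ[ℂ] W'.restrictScalars ℂ := e.restrictScalars ℂ
  refine ⟨fun v hv => hU.mulVec_mem W' hv, ?_⟩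
  rw [← LinearMap.det_conj _ e']
  congr 1
  ext v : 2
  obtain ⟨w, rfl⟩ := e.surjective v
  calc U *ᵥ (e w : ι → ℂ) = f (U *ᵥ w) := by rw [← hfe, hU]
    _ = e ⟨U *ᵥ w, hW w w.2⟩ := hfe ⟨_, hW w w.2⟩
    _ = e ⟨U *ᵥ (e.symm (e w)), _⟩ := by simp only [LinearEquiv.symm_apply_apply]

end Semisimple

section Orthogonality

variable (hR : IsSelfAdjointAction (ι := ι) R)
include hR

theorem IsSelfAdjointAction.exists_isCompl_orthogonal [Algebra ℂ R] [IsScalarTower ℂ R (ι → ℂ)]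
    (W : Submodule R (ι → ℂ)) :
    ∃ W' : Submodule R (ι → ℂ), IsCompl W W' ∧ ∀ v ∈ W, ∀ w ∈ W', star v ⬝ᵥ w = 0 := by
  let W' : Submodule R (ι → ℂ) :=
    { carrier := {w | ∀ v ∈ W, star v ⬝ᵥ w = 0}
      zero_mem' := fun _ _ => dotProduct_zero _
      add_mem' := fun hv hw u hu => by rw [dotProduct_add, hv u hu, hw u hu, add_zero]
      smul_mem' := fun r w hw v hv => by
        obtain ⟨r', hr'⟩ := hR r
        rw [hr', hw _ (W.smul_mem r' hv)] }
  refine ⟨W', ⟨?_, ?_⟩, fun v hv w hw => hw v hv⟩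
  · open scoped ComplexOrder in
    exact Submodule.disjoint_def.mpr fun v hv hv' => dotProduct_star_self_eq_zero.mp (hv' v hv)
  · refine codisjoint_iff.mpr (Submodule.eq_top_iff'.mpr fun v => ?_)
    obtain ⟨y, ⟨y, hy, rfl⟩, z, hz, hyz⟩ := Submodule.exists_add_mem_mem_orthogonal
      (K := (W.restrictScalars ℂ).map (WithLp.linearEquiv 2 ℂ (ι → ℂ)).symm.toLinearMap)
      (WithLp.toLp 2 v)
    refine Submodule.mem_sup.mpr ⟨y, hy, z.ofLp, fun u hu => ?_, (congrArg WithLp.ofLp hyz).symm⟩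
    rw [dotProduct_comm]
    exact (Submodule.mem_orthogonal _ _).mp hz _ ⟨u, hu, rfl⟩

variable [Algebra ℂ R] [IsScalarTower ℂ R (ι → ℂ)]

theorem IsSelfAdjointAction.isSemisimpleModule : IsSemisimpleModule R (ι → ℂ) where
  exists_isCompl W := (hR.exists_isCompl_orthogonal W).imp fun _ => And.left

theorem IsSelfAdjointAction.star_dotProduct_eq_zero {c c' : Submodule R (ι → ℂ)}
    (hc : c ∈ isotypicComponents R (ι → ℂ)) (hc' : c' ∈ isotypicComponents R (ι → ℂ))
    (hne : c ≠ c') {v w : ι → ℂ} (hv : v ∈ c) (hw : w ∈ c') : star v ⬝ᵥ w = 0 := by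
  obtain ⟨q, hq, horth⟩ := hR.exists_isCompl_orthogonal c
  have hdisj : Disjoint c c' := (sSupIndep_isotypicComponents R (ι → ℂ)).pairwiseDisjoint hc hc' hne
  have hproj : c.projection q hq w ∈ c' :=
    Submodule.IsFullyInvariant.of_mem_isotypicComponents hc' _ hw
  refine horth v hv w ((Submodule.projection_apply_eq_zero_iff hq).mp ?_)
  exact Submodule.disjoint_def.mp hdisj _ (Submodule.projection_apply_mem hq w) hproj

end Orthogonality

end Bicommutant

theorem exists_unitary_forall_col_mem {ι Λ : Type*} [Fintype ι] [DecidableEq ι] [Finite Λ]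
    (c : Λ → Submodule ℂ (ι → ℂ)) (htop : ⨆ l, c l = ⊤)
    (horth : ∀ l m, l ≠ m → ∀ v ∈ c l, ∀ w ∈ c m, star v ⬝ᵥ w = 0) :
    ∃ (B : unitaryGroup ι ℂ) (f : ι → Λ), ∀ i, (B : Matrix ι ι ℂ).col i ∈ c (f i) := by
  classical
  have := Fintype.ofFinite Λ
  let toLp := (WithLp.linearEquiv 2 ℂ (ι → ℂ)).symm.toLinearMap
  have hfamily : OrthogonalFamily ℂ (fun l => (c l).map toLp)
      fun l => ((c l).map toLp).subtypeₗᵢ := by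
    rintro l m hlm ⟨_, v, hv, rfl⟩ ⟨_, w, hw, rfl⟩
    exact (dotProduct_comm _ _).trans (horth l m hlm v hv w hw)
  have hinternal : DirectSum.IsInternal fun l => (c l).map toLp := by
    rw [hfamily.isInternal_iff, ← Submodule.map_iSup, htop, Submodule.map_top, LinearEquiv.range,
      Submodule.top_orthogonal_eq_bot]
  have hcard : Module.finrank ℂ (EuclideanSpace ℂ ι) = Fintype.card ι := finrank_euclideanSpace
  let b := (hinternal.subordinateOrthonormalBasis hcard hfamily).reindex (Fintype.equivFin ι).symm
  refine ⟨⟨_, (EuclideanSpace.basisFun ι ℂ).toMatrix_orthonormalBasis_mem_unitary b⟩, fun i =>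
    hinternal.subordinateOrthonormalBasisIndex hcard (Fintype.equivFin ι i) hfamily, fun i => ?_⟩
  obtain ⟨v, hv, hvb⟩ := hinternal.subordinateOrthonormalBasis_subordinate hcard
    (Fintype.equivFin ι i) hfamily
  have hcol : ((EuclideanSpace.basisFun ι ℂ).toBasis.toMatrix b).col i = v := by
    ext j
    rw [Matrix.col_apply, Module.Basis.toMatrix_apply, OrthonormalBasis.coe_toBasis_repr_apply,
      EuclideanSpace.basisFun_repr]
    simp only [b, OrthonormalBasis.reindex_apply, Equiv.symm_symm, ← hvb]
    rfl
  exact hcol ▸ hv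

section Sectors

variable {R M : Type*} [Ring R] [AddCommGroup M] [Module R M]

/-- A simple submodule of isotypic type `c`, chosen once and for all; in the Schur–Weyl
decomposition, a copy of the sector `S^λ`. -/
def sector (c : isotypicComponents R M) : Submodule R M :=
  c.2.choose

instance isSimpleModule_sector (c : isotypicComponents R M) : IsSimpleModule R (sector c) :=
  c.2.choose_spec.1

theorem isotypicComponent_sector (c : isotypicComponents R M) :
    isotypicComponent R M (sector c) = c :=
  c.2.choose_spec.2.symm

theorem sector_le (c : isotypicComponents R M) : sector c ≤ c :=
  (Submodule.le_isotypicComponent _).trans_eq (isotypicComponent_sector c)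

theorem eq_of_sector_linearEquiv {c c' : isotypicComponents R M} (e : sector c ≃ₗ[R] sector c') :
    c = c' := by
  rw [Subtype.ext_iff, ← isotypicComponent_sector c, ← isotypicComponent_sector c',
    e.isotypicComponent_eq]

theorem exists_sector_linearEquiv (W : Submodule R M) [IsSimpleModule R W] :
    ∃ c : isotypicComponents R M, Nonempty (sector c ≃ₗ[R] W) := by
  let c : isotypicComponents R M := ⟨isotypicComponent R M W, W, inferInstance, rfl⟩
  exact ⟨c, isIsotypicOfType_submodule_iff.mp (IsIsotypicOfType.isotypicComponent R M W) (sector c)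
    (sector_le c)⟩

theorem finrank_sector_ne_zero {K : Type*} [Field K] [Algebra K R] [Module K M]
    [IsScalarTower K R M] [FiniteDimensional K M] (c : isotypicComponents R M) :
    Module.finrank K (sector c) ≠ 0 := by
  have := IsSimpleModule.nontrivial R (sector c)
  have : FiniteDimensional K (sector c) :=
    inferInstanceAs (FiniteDimensional K ((sector c).restrictScalars K))
  exact Module.finrank_pos.ne'

end Sectors

section Phases

variable {ι : Type*} [Fintype ι] [DecidableEq ι]

/-- The diagonal unitary with entries `c i`. -/
def diagonalUnitary (c : ι → Circle) : unitaryGroup ι ℂ :=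
  ⟨diagonal fun i => (c i : ℂ), mem_unitaryGroup_iff.mpr <| by
    rw [star_eq_conjTranspose, diagonal_conjTranspose, diagonal_mul_diagonal, ← diagonal_one]
    congr 1
    ext i
    simp [Complex.mul_conj]⟩

variable (ι) (R : Type*) [Ring R] [Module R (ι → ℂ)]

/-- An orthonormal basis of `ι → ℂ`, given by the columns of `basis`, which is adapted to the
decomposition into isotypic components of the action of `R`. -/
structure IsotypicBasis where
  basis : unitaryGroup ι ℂ
  component : ι → isotypicComponents R (ι → ℂ)
  coord_eq_zero : ∀ c : isotypicComponents R (ι → ℂ), ∀ v ∈ c.1, ∀ i, component i ≠ c →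
    (star (basis : Matrix ι ι ℂ) *ᵥ v) i = 0

variable {ι R}

theorem IsSelfAdjointAction.nonempty_isotypicBasis [Algebra ℂ R] [IsScalarTower ℂ R (ι → ℂ)]
    (hR : IsSelfAdjointAction (ι := ι) R) : Nonempty (IsotypicBasis ι R) := by
  have := hR.isSemisimpleModule
  have : IsNoetherian R (ι → ℂ) := isNoetherian_of_tower ℂ inferInstance
  have htop : ⨆ c : isotypicComponents R (ι → ℂ), c.1.restrictScalars ℂ = ⊤ := by
    rw [← Submodule.restrictScalars_iSup, ← sSup_eq_iSup', sSup_isotypicComponents,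
      Submodule.restrictScalars_top]
  obtain ⟨B, component, hmem⟩ := exists_unitary_forall_col_mem _ htop
    fun c c' hne v hv w hw =>
      hR.star_dotProduct_eq_zero c.2 c'.2 (Subtype.coe_injective.ne hne) hv hw
  exact ⟨B, component, fun c v hv i hi =>
    hR.star_dotProduct_eq_zero (component i).2 c.2 (Subtype.coe_injective.ne hi) (hmem i) hv⟩

namespace IsotypicBasis

variable (b : IsotypicBasis ι R) (ζ : isotypicComponents R (ι → ℂ) → Circle)

/-- The unitary which multiplies each isotypic component `c` by the relative phase `ζ c`. -/
def phase : unitaryGroup ι ℂ :=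
  b.basis * diagonalUnitary (fun i => ζ (b.component i)) * b.basis⁻¹

theorem phase_mulVec {c : isotypicComponents R (ι → ℂ)} {v : ι → ℂ} (hv : v ∈ c.1) :
    (b.phase ζ : Matrix ι ι ℂ) *ᵥ v = (ζ c : ℂ) • v := by
  have hdiag : (diagonalUnitary (fun i => ζ (b.component i)) : Matrix ι ι ℂ) *ᵥ
      (star (b.basis : Matrix ι ι ℂ) *ᵥ v) =
        (ζ c : ℂ) • (star (b.basis : Matrix ι ι ℂ) *ᵥ v) := by
    ext i
    rw [diagonalUnitary, mulVec_diagonal, Pi.smul_apply, smul_eq_mul]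
    obtain rfl | hi := eq_or_ne (b.component i) c
    · rfl
    · rw [b.coord_eq_zero c v hv i hi, mul_zero, mul_zero]
  calc (b.phase ζ : Matrix ι ι ℂ) *ᵥ v
      = (b.basis : Matrix ι ι ℂ) *ᵥ ((diagonalUnitary (fun i => ζ (b.component i)) :
        Matrix ι ι ℂ) *ᵥ (star (b.basis : Matrix ι ι ℂ) *ᵥ v)) := by
        rw [mulVec_mulVec, mulVec_mulVec]
        rfl
    _ = (ζ c : ℂ) • v := by
        rw [hdiag, mulVec_smul, mulVec_mulVec, mem_unitaryGroup_iff.mp b.basis.2, one_mulVec]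

theorem mul_momentMatrix_phase_eq_self_iff {k : ℕ} {α : Type*}
    (T : Matrix α ((Fin k → ι) × (Fin k → ι)) ℂ) :
    T * momentMatrix k (b.phase ζ : Matrix ι ι ℂ) = T ↔
      ∀ a x y, (T * momentMatrix k (b.basis : Matrix ι ι ℂ)) a (x, y) ≠ 0 →
        ∏ i, ζ (b.component (x i)) = ∏ i, ζ (b.component (y i)) := by
  rw [← mul_momentMatrix_diagonal_eq_self_iff k fun i => ζ (b.component i)]
  have hinv : momentMatrix k (b.basis : Matrix ι ι ℂ) *
      momentMatrix k (star (b.basis : Matrix ι ι ℂ)) = 1 := by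
    rw [← momentMatrix_mul, mem_unitaryGroup_iff.mp b.basis.2, momentMatrix_one]
  have hphase : momentMatrix k (b.phase ζ : Matrix ι ι ℂ) =
      momentMatrix k (b.basis : Matrix ι ι ℂ) *
        momentMatrix k (diagonal fun i => (ζ (b.component i) : ℂ)) *
        momentMatrix k (star (b.basis : Matrix ι ι ℂ)) := by
    rw [← momentMatrix_mul, ← momentMatrix_mul]
    rfl
  have hinv' := mul_eq_one_comm.mp hinv
  rw [hphase]
  refine ⟨fun h => ?_, fun h => ?_⟩
  · conv_rhs => rw [← h]
    simp only [Matrix.mul_assoc, hinv', Matrix.mul_one]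
  · rw [← Matrix.mul_assoc, ← Matrix.mul_assoc, h, Matrix.mul_assoc, hinv, Matrix.mul_one]

variable [Algebra ℂ R] [IsScalarTower ℂ R (ι → ℂ)]

theorem hasDetOn_sector_phase (c : isotypicComponents R (ι → ℂ)) :
    HasDetOn ((sector c).restrictScalars ℂ) (b.phase ζ)
      ((ζ c : ℂ) ^ Module.finrank ℂ (sector c)) :=
  hasDetOn_of_mulVec_eq_smul fun _ hv => b.phase_mulVec ζ (sector_le c hv)

variable [IsSemisimpleModule R (ι → ℂ)]

theorem memBicommutant_phase : MemBicommutant R (b.phase ζ : Matrix ι ι ℂ) := by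
  intro f v
  have hv : v ∈ ⨆ c : isotypicComponents R (ι → ℂ), c.1 := by
    rw [← sSup_eq_iSup', sSup_isotypicComponents]
    exact Submodule.mem_top
  refine Submodule.iSup_induction _ (motive := fun v => (b.phase ζ : Matrix ι ι ℂ) *ᵥ f v =
    f ((b.phase ζ : Matrix ι ι ℂ) *ᵥ v)) hv (fun c w hw => ?_) ?_ fun w w' hw hw' => ?_
  · have hfw : f w ∈ c.1 := Submodule.IsFullyInvariant.of_mem_isotypicComponents c.2 f hw
    rw [b.phase_mulVec ζ hfw, b.phase_mulVec ζ hw, LinearMap.map_smul_of_tower]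
  · simp only [map_zero, mulVec_zero]
  · simp only [map_add, mulVec_add, hw, hw']

end IsotypicBasis

section SectorDeterminants

variable [Algebra ℂ R] [IsScalarTower ℂ R (ι → ℂ)] [IsSemisimpleModule R (ι → ℂ)]

theorem MemBicommutant.hasDetOneOn {U : Matrix ι ι ℂ} (hU : MemBicommutant R U)
    (h : ∀ c : isotypicComponents R (ι → ℂ), HasDetOneOn ((sector c).restrictScalars ℂ) U)
    (W : Submodule R (ι → ℂ)) [IsSimpleModule R W] : HasDetOneOn (W.restrictScalars ℂ) U := by
  obtain ⟨c, ⟨e⟩⟩ := exists_sector_linearEquiv W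
  exact hU.hasDetOn_of_linearEquiv e (h c)

theorem MemBicommutant.exists_phase_mul_hasDetOneOn (b : IsotypicBasis ι R) {U : unitaryGroup ι ℂ}
    (hU : MemBicommutant R (U : Matrix ι ι ℂ)) :
    ∃ ζ, ∀ c : isotypicComponents R (ι → ℂ), HasDetOneOn ((sector c).restrictScalars ℂ)
      (b.phase ζ * U : Matrix ι ι ℂ) := by
  have hroot (c : isotypicComponents R (ι → ℂ)) : ∃ z : Circle,
      HasDetOn ((sector c).restrictScalars ℂ) U ((z : ℂ) ^ Module.finrank ℂ (sector c))⁻¹ := by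
    obtain ⟨δ, hδ⟩ := hU.exists_hasDetOn (sector c)
    let δ' : Circle := ⟨δ, mem_sphere_zero_iff_norm.mpr (hδ.norm_eq_one U.2)⟩
    obtain ⟨z, hz⟩ := exists_circle_pow_eq (finrank_sector_ne_zero (K := ℂ) c) δ'⁻¹
    refine ⟨z, ?_⟩
    rwa [← Circle.coe_pow, hz, ← Circle.coe_inv, inv_inv]
  choose ζ hζ using hroot
  refine ⟨ζ, fun c => ?_⟩
  have hdet := (b.hasDetOn_sector_phase ζ c).mul (hζ c)
  rwa [mul_inv_cancel₀ (pow_ne_zero _ (Circle.coe_ne_zero _))] at hdet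

end SectorDeterminants

theorem IsotypicBasis.momentOperator_mul_momentMatrix_phase [Algebra ℂ R]
    [IsScalarTower ℂ R (ι → ℂ)] (b : IsotypicBasis ι R) {k : ℕ}
    {H : Subgroup (unitaryGroup ι ℂ)} [CompactSpace H]
    (hk : {c : isotypicComponents R (ι → ℂ) | Module.finrank ℂ (sector c) ≤ k}.Subsingleton)
    (hH : ∀ ζ, (∀ c, ζ c ^ Module.finrank ℂ (sector c) = 1) → b.phase ζ ∈ H) (ζ) :
    momentOperator k H * momentMatrix k (b.phase ζ : Matrix ι ι ℂ) = momentOperator k H := by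
  rw [b.mul_momentMatrix_phase_eq_self_iff]
  intro a x y hne
  refine prod_eq_prod_of_map_univ_eq (f := b.component ∘ x) (g := b.component ∘ y) ?_ ζ
  refine map_univ_eq_of_forall_prod_eq (fun c => Module.finrank ℂ (sector c)) finrank_sector_ne_zero
    (by simpa only [Fintype.card_fin] using hk) fun ξ hξ => ?_
  exact (b.mul_momentMatrix_phase_eq_self_iff ξ _).mp
    (momentOperator_mul_momentMatrix k (hH ξ hξ)) a x y hne

theorem IsSelfAdjointAction.momentOperator_mul_of_memBicommutant [Algebra ℂ R]
    [IsScalarTower ℂ R (ι → ℂ)] (hR : IsSelfAdjointAction (ι := ι) R) {k : ℕ}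
    (hk : ∀ S T : Submodule R (ι → ℂ), IsSimpleModule R S → IsSimpleModule R T →
      Module.finrank ℂ S ≤ k → Module.finrank ℂ T ≤ k → Nonempty (S ≃ₗ[R] T))
    {H : Subgroup (unitaryGroup ι ℂ)} [CompactSpace H]
    (hH : ∀ V : unitaryGroup ι ℂ, MemBicommutant R (V : Matrix ι ι ℂ) →
      (∀ W : Submodule R (ι → ℂ), IsSimpleModule R W →
        HasDetOneOn (W.restrictScalars ℂ) (V : Matrix ι ι ℂ)) → V ∈ H)
    {U : unitaryGroup ι ℂ} (hU : MemBicommutant R (U : Matrix ι ι ℂ)) :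
    momentOperator k H * momentMatrix k (U : Matrix ι ι ℂ) = momentOperator k H := by
  have := hR.isSemisimpleModule
  obtain ⟨b⟩ := hR.nonempty_isotypicBasis
  have hphase (ζ) : momentOperator k H * momentMatrix k (b.phase ζ : Matrix ι ι ℂ) =
      momentOperator k H := by
    refine b.momentOperator_mul_momentMatrix_phase (fun c hc c' hc' => ?_) (fun ξ hξ => ?_) ζ
    · exact eq_of_sector_linearEquiv (hk _ _ inferInstance inferInstance hc hc').some
    · refine hH _ (b.memBicommutant_phase ξ) fun W hW =>
        (b.memBicommutant_phase ξ).hasDetOneOn (fun c => ?_) W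
      have hdet := b.hasDetOn_sector_phase ξ c
      rwa [← Circle.coe_pow, hξ c] at hdet
  obtain ⟨ζ, hζ⟩ := hU.exists_phase_mul_hasDetOneOn b
  have hmem : b.phase ζ * U ∈ H :=
    have hmul := (b.memBicommutant_phase ζ).mul hU
    hH _ hmul fun W _ => hmul.hasDetOneOn hζ W
  calc momentOperator k H * momentMatrix k (U : Matrix ι ι ℂ)
      = momentOperator k H * momentMatrix k (b.phase ζ : Matrix ι ι ℂ) *
          momentMatrix k (U : Matrix ι ι ℂ) := by rw [hphase]
    _ = momentOperator k H * momentMatrix k (b.phase ζ * U : unitaryGroup ι ℂ) := by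
        rw [Matrix.mul_assoc, ← momentMatrix_mul, Submonoid.coe_mul]
    _ = momentOperator k H := momentOperator_mul_momentMatrix k hmem

end Phases

/-! ### Small representations of the symmetric group -/

section Involutions

variable {K V : Type*} [Field K] [AddCommGroup V] [Module K V] {f g h : Module.End K V}

theorem sub_mem_eigenspace_neg_one (hf : ∀ x, f (f x) = x) (x : V) :
    x - f x ∈ f.eigenspace (-1) := by
  rw [Module.End.mem_eigenspace_iff, map_sub, hf, neg_one_smul, neg_sub]

theorem add_mem_eigenspace_one (hf : ∀ x, f (f x) = x) (x : V) :
    x + f x ∈ f.eigenspace 1 := by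
  rw [Module.End.mem_eigenspace_iff, map_add, hf, one_smul, add_comm]

variable [CharZero K]

theorem finrank_eigenspace_neg_one_add_finrank_eigenspace_one_le [FiniteDimensional K V]
    (f : Module.End K V) :
    Module.finrank K (f.eigenspace (-1)) + Module.finrank K (f.eigenspace 1) ≤
      Module.finrank K V :=
  Submodule.finrank_add_finrank_le_of_disjoint
    (f.eigenspaces_iSupIndep.pairwiseDisjoint (neg_ne_self.mpr one_ne_zero))

theorem eq_of_eqOn_eigenspaces (hf : ∀ x, f (f x) = x)
    (hneg : ∀ x ∈ f.eigenspace (-1), g x = h x) (hpos : ∀ x ∈ f.eigenspace 1, g x = h x) :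
    g = h := by
  ext x
  have htwo : (2 : K) • x = (x + f x) + (x - f x) := by module
  refine smul_right_injective V (two_ne_zero (α := K)) ?_
  simp only [← map_smul, htwo, map_add g (x + f x), map_add h (x + f x),
    hpos _ (add_mem_eigenspace_one hf x), hneg _ (sub_mem_eigenspace_neg_one hf x)]

theorem eq_of_eigenspace_neg_one_eq (hf : ∀ x, f (f x) = x) (hg : ∀ x, g (g x) = x)
    (hcomm : ∀ x, f (g x) = g (f x)) (heq : f.eigenspace (-1) = g.eigenspace (-1)) : f = g := by
  refine eq_of_eqOn_eigenspaces hf (fun x hx => ?_) fun x hx => ?_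
  · rw [Module.End.mem_eigenspace_iff.mp hx, Module.End.mem_eigenspace_iff.mp (heq ▸ hx)]
  · have := IsAddTorsionFree.of_isTorsionFree K V
    rw [Module.End.mem_eigenspace_iff, one_smul] at hx
    have hsub := heq ▸ sub_mem_eigenspace_neg_one hg x
    rw [Module.End.mem_eigenspace_iff, map_sub, hcomm, hx, neg_one_smul, self_eq_neg,
      sub_eq_zero] at hsub
    exact hx.trans hsub

end Involutions

section SymmetricGroup

open Equiv

theorem exists_perm_map_pair {α : Type*} {a b c d : α} (hab : a ≠ b) (hcd : c ≠ d) :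
    ∃ σ : Perm α, σ a = c ∧ σ b = d ∧ ∀ x, x ∉ [a, b, c, d] → σ x = x := by
  classical
  refine ⟨swap (swap a c b) d * swap a c, ?_, ?_, fun x hx => ?_⟩
  · rw [Perm.mul_apply, swap_apply_left, swap_apply_of_ne_of_ne _ hcd]
    grind
  · rw [Perm.mul_apply, swap_apply_left]
  · grind [Perm.mul_apply]

variable {α K V : Type*} [DecidableEq α] [Field K] [AddCommGroup V] [Module K V]
  (ρ : Representation K (Perm α) V)

theorem rep_swap_rep_swap (a b : α) (x : V) : ρ (swap a b) (ρ (swap a b) x) = x := by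
  rw [← Module.End.mul_apply, ← map_mul, Equiv.swap_mul_self, map_one, Module.End.one_apply]

theorem rep_apply_rep_swap (σ : Perm α) (a b : α) (x : V) :
    ρ σ (ρ (swap a b) x) = ρ (swap (σ a) (σ b)) (ρ σ x) := by
  simp only [← Module.End.mul_apply, ← map_mul, mul_swap_eq_swap_mul]

variable {ρ}

theorem rep_swap_eq_of_forall_commute {a b c d : α} (hab : a ≠ b) (hcd : c ≠ d)
    (hcomm : ∀ σ x, ρ σ (ρ (swap a b) x) = ρ (swap a b) (ρ σ x)) :
    ρ (swap a b) = ρ (swap c d) := by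
  obtain ⟨σ, rfl, rfl, -⟩ := exists_perm_map_pair hab hcd
  ext x
  rw [← ρ.self_inv_apply σ x, ← rep_apply_rep_swap, hcomm]

theorem rep_swap_eq_of_finrank_le_one [FiniteDimensional K V] (hdim : Module.finrank K V ≤ 1)
    {a b c d : α} (hab : a ≠ b) (hcd : c ≠ d) : ρ (swap a b) = ρ (swap c d) := by
  obtain ⟨v, hv⟩ := finrank_le_one_iff.mp hdim
  refine rep_swap_eq_of_forall_commute hab hcd fun σ x => ?_
  obtain ⟨r, hr⟩ := hv (ρ (swap a b) v)
  obtain ⟨s, hs⟩ := hv (ρ σ v)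
  obtain ⟨t, rfl⟩ := hv x
  simp only [map_smul, ← hr, ← hs, smul_comm s]

theorem finrank_eigenspace_rep_swap_le [FiniteDimensional K V] {a b c d : α} (hab : a ≠ b)
    (hcd : c ≠ d) (r : K) :
    Module.finrank K (Module.End.eigenspace (ρ (swap a b)) r) ≤
      Module.finrank K (Module.End.eigenspace (ρ (swap c d)) r) := by
  obtain ⟨σ, rfl, rfl, -⟩ := exists_perm_map_pair hab hcd
  refine LinearMap.finrank_le_finrank_of_injective (f := (ρ σ).restrict fun x hx => ?_) ?_
  · rw [Module.End.mem_eigenspace_iff] at hx ⊢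
    rw [← rep_apply_rep_swap, hx, map_smul]
  · exact fun x y hxy => Subtype.ext ((ρ.apply_bijective σ).injective (congrArg Subtype.val hxy))

end SymmetricGroup

section RootFamily

open Equiv

variable {α K V : Type*} [DecidableEq α] [Field K] [AddCommGroup V] [Module K V]
  {ρ : Representation K (Perm α) V}

/-- The vectors `u i j`, `i ≠ j`, of `V` behave like the roots `e i - e j` of the standard
representation: they are permuted by the symmetric group, and the transposition of `i` and `j`
moves every vector by a multiple of `u i j`. Nothing is required of `u i i`. -/
structure IsRootFamily (ρ : Representation K (Perm α) V) (u : α → α → V) : Prop where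
  apply : ∀ σ i j, i ≠ j → ρ σ (u i j) = u (σ i) (σ j)
  ne_zero : ∀ i j, i ≠ j → u i j ≠ 0
  neg : ∀ i j, i ≠ j → u j i = -u i j
  reflection : ∀ i j x, i ≠ j → ∃ r : K, x - ρ (swap i j) x = r • u i j

namespace IsRootFamily

variable {u : α → α → V} (hu : IsRootFamily ρ u)

include hu

theorem rep_swap_apply_left {i j k : α} (hik : i ≠ k) (hjk : j ≠ k) :
    ρ (swap i j) (u i k) = u j k := by
  rw [hu.apply _ _ _ hik, swap_apply_left, swap_apply_of_ne_of_ne hik.symm hjk.symm]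

theorem rep_swap_apply_right {i j k : α} (hik : i ≠ k) (hjk : j ≠ k) :
    ρ (swap i j) (u k i) = u k j := by
  rw [hu.apply _ _ _ hik.symm, swap_apply_left, swap_apply_of_ne_of_ne hik.symm hjk.symm]

theorem rep_swap_apply_self {i j : α} (hij : i ≠ j) : ρ (swap i j) (u i j) = u j i := by
  rw [hu.apply _ _ _ hij, swap_apply_left, swap_apply_right]

variable [CharZero K]

theorem apply_ne {j k l : α} (hjk : j ≠ k) (hjl : j ≠ l) (hkl : k ≠ l) : u j k ≠ u j l := by
  have := IsAddTorsionFree.of_isTorsionFree K V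
  intro h
  have hk : u k j = u k l := by
    rw [← hu.rep_swap_apply_self hjk, h, hu.rep_swap_apply_left hjl hkl]
  have hl : u l k = u l j := by
    rw [← hu.rep_swap_apply_left hjk hkl.symm, h, hu.rep_swap_apply_self hjl]
  refine hu.ne_zero j k hjk (self_eq_neg.mp ?_)
  calc u j k = u j l := h
    _ = -u l k := by rw [hl, hu.neg j l hjl, neg_neg]
    _ = u k j := by rw [hu.neg k l hkl, neg_neg, hk]
    _ = -u j k := hu.neg j k hjk

/-- If `u i k - u j k = r • u i j` with `r ≠ 1`, then `u j k` is a multiple of `u i j`, hence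
independent of `k`. -/
theorem add_eq {i j k l : α} (hij : i ≠ j) (hik : i ≠ k) (hjk : j ≠ k) (hl : l ∉ [i, j, k]) :
    u i j + u j k = u i k := by
  simp only [List.mem_cons, List.not_mem_nil, or_false, not_or] at hl
  obtain ⟨hli, hlj, hlk⟩ := hl
  obtain ⟨r, hr⟩ := hu.reflection i j (u i k) hij
  rw [hu.rep_swap_apply_left hik hjk] at hr
  have hswap : u i j + u j k = r • u i k := by
    have := congrArg (ρ (swap k j)) hr
    rwa [map_sub, map_smul, hu.rep_swap_apply_right hik.symm hij.symm, Equiv.swap_comm,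
      hu.rep_swap_apply_self hjk, hu.rep_swap_apply_right hij.symm hik.symm, hu.neg j k hjk,
      sub_neg_eq_add] at this
  by_cases hr1 : r = 1
  · rw [hswap, hr1, one_smul]
  exfalso
  have hsmul : (1 - r) • (u j k - -(1 + r) • u i j) = 0 := by
    calc (1 - r) • (u j k - -(1 + r) • u i j)
        = (u i j + u j k - r • u i k) + r • (u i k - u j k - r • u i j) := by module
      _ = 0 := by rw [hswap, hr, sub_self, sub_self, smul_zero, add_zero]
  have hjk_eq : u j k = -(1 + r) • u i j :=
    sub_eq_zero.mp ((smul_eq_zero.mp hsmul).resolve_left (sub_ne_zero.mpr (Ne.symm hr1)))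
  have hjl_eq : u j l = -(1 + r) • u i j := by
    rw [← hu.rep_swap_apply_right (Ne.symm hjk) hlj, hjk_eq, map_smul, hu.apply _ _ _ hij,
      swap_apply_of_ne_of_ne hik (Ne.symm hli), swap_apply_of_ne_of_ne hjk (Ne.symm hlj)]
  exact hu.apply_ne hjk (Ne.symm hlj) (Ne.symm hlk) (hjk_eq.trans hjl_eq.symm)

theorem sub_rep_swap_apply [Fintype α] (hcard : 4 ≤ Fintype.card α) {a b j : α} (hab : a ≠ b)
    (haj : a ≠ j) :
    u a j - ρ (swap a b) (u a j) = (1 + if j = b then 1 else 0 : K) • u a b := by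
  split_ifs with hjb
  · rw [hjb, hu.rep_swap_apply_self hab, hu.neg a b hab]
    module
  · obtain ⟨l, -, hl⟩ := Finset.exists_mem_notMem_of_card_lt_card (s := {a, b, j})
      (t := Finset.univ) (Finset.card_le_three.trans_lt hcard)
    have hadd := hu.add_eq hab haj (Ne.symm hjb) (by simpa using hl)
    rw [hu.rep_swap_apply_left haj (Ne.symm hjb), ← hadd]
    module

theorem linearIndependent [Fintype α] (hcard : 4 ≤ Fintype.card α) (a : α) :
    LinearIndependent K fun j : {j // j ≠ a} => u a j := by
  rw [Fintype.linearIndependent_iff]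
  intro w hw
  have hsum (b : {j // j ≠ a}) : ∑ j, w j + w b = 0 := by
    have hrep (j : {j // j ≠ a}) := hu.sub_rep_swap_apply hcard b.2.symm j.2.symm
    have hsmul : (∑ j, w j + w b) • u a b = 0 := by
      calc (∑ j, w j + w b) • u a b
          = ∑ j, w j • (u a j - ρ (swap a b) (u a j)) := by
            simp only [hrep, smul_smul,
              ← Finset.sum_smul, mul_add, mul_one, mul_ite, mul_zero, Finset.sum_add_distrib,
              Subtype.coe_inj, Finset.sum_ite_eq', Finset.mem_univ, if_true]
        _ = 0 := by
            simp only [smul_sub, Finset.sum_sub_distrib, ← map_smul, ← map_sum, hw, map_zero,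
              sub_zero]
    exact (smul_eq_zero.mp hsmul).resolve_right (hu.ne_zero a b b.2.symm)
  have htotal : (Fintype.card {j // j ≠ a} + 1 : K) * ∑ j, w j = 0 := by
    have := Finset.sum_congr rfl fun b (_ : b ∈ Finset.univ) => hsum b
    rw [Finset.sum_add_distrib, Finset.sum_const, Finset.sum_const_zero, Finset.card_univ,
      nsmul_eq_mul] at this
    rw [add_one_mul, this]
  intro b
  have hzero := (mul_eq_zero.mp htotal).resolve_left (Nat.cast_add_one_ne_zero _)
  rw [← hsum b, hzero, zero_add]

theorem card_le_finrank_add_one [Fintype α] [FiniteDimensional K V]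
    (hcard : 4 ≤ Fintype.card α) : Fintype.card α ≤ Module.finrank K V + 1 := by
  have : Nonempty α := Fintype.card_pos_iff.mp (by lia)
  have hle := (hu.linearIndependent hcard (Classical.arbitrary α)).fintype_card_le_finrank
  rw [Fintype.card_subtype_compl, Fintype.card_subtype_eq] at hle
  lia

end IsRootFamily

end RootFamily

section SmallDimension

open Equiv

/-- Any two disjoint transpositions act in the same way. -/
def DisjointSwapsAgree {α K V : Type*} [DecidableEq α] [Field K] [AddCommGroup V] [Module K V]
    (ρ : Representation K (Perm α) V) : Prop :=
  ∀ ⦃a b c d : α⦄, [a, b, c, d].Nodup → ρ (swap a b) = ρ (swap c d)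

variable {α K V : Type*} [DecidableEq α] [Field K] [AddCommGroup V] [Module K V]
  {ρ : Representation K (Perm α) V}

theorem disjointSwapsAgree_of_rep_swap_eq {a b j k : α} (hnodup : [a, b, j, k].Nodup)
    (h : ρ (swap a b) = ρ (swap j k)) : DisjointSwapsAgree ρ := by
  intro a' b' c d hnodup'
  simp only [List.nodup_cons, List.mem_cons, List.not_mem_nil, or_false, not_or] at hnodup hnodup'
  obtain ⟨σ, rfl, rfl, -⟩ := exists_perm_map_pair (c := a') (d := b') (by tauto) (by tauto)
  obtain ⟨τ, hτj, hτk, hτ⟩ := exists_perm_map_pair (a := σ j) (b := σ k) (c := c) (d := d)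
    (σ.injective.ne (by tauto)) (by tauto)
  have hτa : τ (σ a) = σ a := hτ _ (by
    simp only [List.mem_cons, σ.injective.eq_iff, List.not_mem_nil, or_false]; tauto)
  have hτb : τ (σ b) = σ b := hτ _ (by
    simp only [List.mem_cons, σ.injective.eq_iff, List.not_mem_nil, or_false]; tauto)
  ext x
  rw [← ρ.self_inv_apply (τ * σ) x, ← hτa, ← hτb, ← hτj, ← hτk]
  simp only [← Perm.mul_apply, ← rep_apply_rep_swap, h]

theorem rep_apply_eq_self_of_swap [Finite α] {a b : α} (hab : a ≠ b) {v : V}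
    (h : ∀ j k, [a, b, j, k].Nodup → ρ (swap j k) v = v) {σ : Perm α} (ha : σ a = a)
    (hb : σ b = b) : ρ σ v = v := by
  let p : α → Prop := fun x => x ≠ a ∧ x ≠ b
  have hp (x : α) : p (σ x) ↔ p x :=
    and_congr (σ.injective.ne_iff' ha) (σ.injective.ne_iff' hb)
  have hσ : Perm.ofSubtype (σ.subtypePerm hp) = σ :=
    Perm.ofSubtype_subtypePerm hp fun x hx =>
      ⟨fun hxa => hx (hxa ▸ ha), fun hxb => hx (hxb ▸ hb)⟩
  rw [← hσ]
  induction σ.subtypePerm hp using Perm.swap_induction_on with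
  | one => rw [map_one, map_one, Module.End.one_apply]
  | swap_mul τ x y hxy ih =>
    rw [map_mul, map_mul, Module.End.mul_apply, ih, Perm.ofSubtype_swap_eq]
    exact h x y (by grind)

theorem exists_isRootFamily [Finite α] {a b : α} (hab : a ≠ b) {v : V} (hv : v ≠ 0)
    (hspan : ∀ x, ∃ r : K, x - ρ (swap a b) x = r • v) (hneg : ρ (swap a b) v = -v)
    (hfix : ∀ j k, [a, b, j, k].Nodup → ρ (swap j k) v = v) : ∃ u, IsRootFamily ρ u := by
  have hvalue (i j : α) : ∃ w, i ≠ j → ∀ σ : Perm α, σ a = i → σ b = j → ρ σ v = w := by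
    by_cases hij : i = j
    · exact ⟨0, fun h => absurd hij h⟩
    obtain ⟨τ, hτa, hτb, -⟩ := exists_perm_map_pair hab hij
    refine ⟨ρ τ v, fun _ σ hσa hσb => ?_⟩
    have hfixed := rep_apply_eq_self_of_swap hab hfix (σ := τ⁻¹ * σ)
      (by rw [Perm.mul_apply, hσa, Perm.inv_eq_iff_eq, hτa])
      (by rw [Perm.mul_apply, hσb, Perm.inv_eq_iff_eq, hτb])
    rwa [map_mul, Module.End.mul_apply, ρ.inv_apply_eq_iff] at hfixed
  choose u hu using hvalue
  have hrep {i j : α} (hij : i ≠ j) : ∃ σ : Perm α, σ a = i ∧ σ b = j ∧ ρ σ v = u i j := by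
    obtain ⟨σ, ha, hb, -⟩ := exists_perm_map_pair hab hij
    exact ⟨σ, ha, hb, hu i j hij σ ha hb⟩
  refine ⟨u, fun τ i j hij => ?_, fun i j hij => ?_, fun i j hij => ?_, fun i j x hij => ?_⟩ <;>
    obtain ⟨σ, rfl, rfl, hσ⟩ := hrep hij
  · rw [← hσ, ← Module.End.mul_apply, ← map_mul]
    exact hu _ _ (τ.injective.ne hij) (τ * σ) rfl rfl
  · rw [← hσ]
    exact (map_ne_zero_iff _ (ρ.apply_bijective σ).injective).mpr hv
  · rw [← hσ, ← map_neg, ← hneg, ← Module.End.mul_apply, ← map_mul]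
    refine (hu _ _ hij.symm (σ * swap a b) ?_ ?_).symm
    · rw [Perm.mul_apply, swap_apply_left]
    · rw [Perm.mul_apply, swap_apply_right]
  · obtain ⟨r, hr⟩ := hspan (ρ σ⁻¹ x)
    refine ⟨r, ?_⟩
    rw [← hσ, ← map_smul, ← hr, map_sub, rep_apply_rep_swap, ρ.self_inv_apply]

variable (ρ) in
/-- The tensor product of `ρ` with the sign character; it exchanges the eigenvalues `1` and `-1`
of the transpositions. -/
def signTwist [Fintype α] : Representation K (Perm α) V where
  toFun σ := ((Perm.sign σ : ℤ) : K) • ρ σ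
  map_one' := by rw [Perm.sign_one, Units.val_one, Int.cast_one, one_smul, map_one]
  map_mul' σ τ := by
    rw [Perm.sign_mul, Units.val_mul, Int.cast_mul, map_mul, smul_mul_smul_comm]

theorem signTwist_swap [Fintype α] {a b : α} (hab : a ≠ b) :
    signTwist ρ (swap a b) = -ρ (swap a b) := by
  change ((Perm.sign (swap a b) : ℤ) : K) • ρ (swap a b) = _
  rw [Perm.sign_swap hab, Units.val_neg, Units.val_one, Int.cast_neg, Int.cast_one, neg_one_smul]

theorem disjointSwapsAgree_of_signTwist [Fintype α] (h : DisjointSwapsAgree (signTwist ρ)) :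
    DisjointSwapsAgree ρ := fun a b c d hnodup => by
  have heq := h hnodup
  rwa [signTwist_swap (by grind), signTwist_swap (by grind), neg_inj] at heq

theorem eigenspace_signTwist_swap [Fintype α] {a b : α} (hab : a ≠ b) :
    Module.End.eigenspace (signTwist ρ (swap a b)) (-1) =
      Module.End.eigenspace (ρ (swap a b)) 1 := by
  ext x
  rw [Module.End.mem_eigenspace_iff, Module.End.mem_eigenspace_iff, signTwist_swap hab,
    LinearMap.neg_apply, neg_smul, neg_inj]

variable (ρ) in
/-- An eigenspace of the transposition of `e` and `f` as a representation of the permutations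
that fix `e` and `f`. -/
def swapEigenspace (e f : α) (r : K) :
    Subrepresentation (ρ.comp (Perm.ofSubtype (p := fun x => x ≠ e ∧ x ≠ f))) where
  toSubmodule := Module.End.eigenspace (ρ (swap e f)) r
  apply_mem_toSubmodule σ v hv := by
    rw [Module.End.mem_eigenspace_iff] at hv ⊢
    have hfix (x : α) (hx : ¬(x ≠ e ∧ x ≠ f)) := Perm.ofSubtype_apply_of_not_mem σ hx
    rw [MonoidHom.comp_apply, ← map_smul, ← hv, rep_apply_rep_swap, hfix e (by tauto),
      hfix f (by tauto)]

theorem rep_swap_eqOn_swapEigenspace {e f : α} {r : K}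
    (h : DisjointSwapsAgree (swapEigenspace ρ e f r).toRepresentation) {a b c d : α}
    (hnodup : [e, f, a, b, c, d].Nodup) {x : V}
    (hx : x ∈ Module.End.eigenspace (ρ (swap e f)) r) : ρ (swap a b) x = ρ (swap c d) x := by
  have hmem {y : α} (hy : y ∈ [a, b, c, d]) : y ≠ e ∧ y ≠ f := by grind
  have heq := h (a := ⟨a, hmem (by grind)⟩) (b := ⟨b, hmem (by grind)⟩) (c := ⟨c, hmem (by grind)⟩)
    (d := ⟨d, hmem (by grind)⟩) (by grind)
  have hval := congrArg Subtype.val (LinearMap.congr_fun heq ⟨x, hx⟩)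
  change ρ (Perm.ofSubtype (swap _ _)) x = ρ (Perm.ofSubtype (swap _ _)) x at hval
  rwa [Perm.ofSubtype_swap_eq, Perm.ofSubtype_swap_eq] at hval

theorem rep_swap_eq_of_disjointSwapsAgree_swapEigenspace [CharZero K] {a b c d e f : α}
    (hnodup : [e, f, a, b, c, d].Nodup)
    (h : ∀ r : K, r = -1 ∨ r = 1 → DisjointSwapsAgree (swapEigenspace ρ e f r).toRepresentation) :
    ρ (swap a b) = ρ (swap c d) :=
  eq_of_eqOn_eigenspaces (rep_swap_rep_swap ρ e f)
    (fun _ hx => rep_swap_eqOn_swapEigenspace (h _ (Or.inl rfl)) hnodup hx)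
    (fun _ hx => rep_swap_eqOn_swapEigenspace (h _ (Or.inr rfl)) hnodup hx)

theorem eq_span_singleton_of_finrank_le_one [FiniteDimensional K V] {E : Submodule K V}
    (hE : Module.finrank K E ≤ 1) {v : V} (hv : v ∈ E) (hv0 : v ≠ 0) : E = K ∙ v :=
  (Submodule.eq_of_le_of_finrank_le ((Submodule.span_singleton_le_iff_mem v E).mpr hv)
    (by rwa [finrank_span_singleton hv0])).symm

variable [CharZero K] [FiniteDimensional K V]

theorem rep_swap_apply_eq_self_or_rep_swap_eq {a b j k : α} (hnodup : [a, b, j, k].Nodup)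
    (hrank : Module.finrank K (Module.End.eigenspace (ρ (swap a b)) (-1)) ≤ 1) {v : V}
    (hv : v ∈ Module.End.eigenspace (ρ (swap a b)) (-1)) (hv0 : v ≠ 0) :
    ρ (swap j k) v = v ∨ ρ (swap a b) = ρ (swap j k) := by
  simp only [List.nodup_cons, List.mem_cons, List.not_mem_nil, or_false, not_or] at hnodup
  have hcomm (x : V) : ρ (swap a b) (ρ (swap j k) x) = ρ (swap j k) (ρ (swap a b) x) := by
    rw [rep_apply_rep_swap, swap_apply_of_ne_of_ne (by tauto) (by tauto),
      swap_apply_of_ne_of_ne (by tauto) (by tauto)]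
  have hspan := eq_span_singleton_of_finrank_le_one hrank hv hv0
  obtain ⟨r, hr⟩ : ∃ r : K, r • v = ρ (swap j k) v := by
    rw [← Submodule.mem_span_singleton, ← hspan, Module.End.mem_eigenspace_iff, hcomm,
      Module.End.mem_eigenspace_iff.mp hv, map_smul]
  have hrr : (r * r - 1) • v = 0 := by
    rw [sub_smul, mul_smul, one_smul, hr, ← map_smul, hr, rep_swap_rep_swap, sub_self]
  rcases mul_self_eq_one_iff.mp (sub_eq_zero.mp ((smul_eq_zero.mp hrr).resolve_right hv0)) with
    rfl | rfl
  · exact Or.inl (by rw [← hr, one_smul])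
  · refine Or.inr (eq_of_eigenspace_neg_one_eq (rep_swap_rep_swap ρ a b) (rep_swap_rep_swap ρ j k)
      hcomm ?_)
    rw [hspan, ← eq_span_singleton_of_finrank_le_one
      ((finrank_eigenspace_rep_swap_le (c := a) (d := b) (by tauto) (by tauto) (-1)).trans hrank)
      (Module.End.mem_eigenspace_iff.mpr hr.symm) hv0]

theorem disjointSwapsAgree_of_finrank_eigenspace_le_one [Fintype α]
    (hdim : Module.finrank K V + 2 ≤ Fintype.card α) {a b : α} (hab : a ≠ b)
    (hrank : Module.finrank K (Module.End.eigenspace (ρ (swap a b)) (-1)) ≤ 1) :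
    DisjointSwapsAgree ρ := by
  by_cases hbot : Module.End.eigenspace (ρ (swap a b)) (-1) = ⊥
  · have hid (x : V) : ρ (swap a b) x = x :=
      (sub_eq_zero.mp ((Submodule.mem_bot K).mp
        (hbot ▸ sub_mem_eigenspace_neg_one (rep_swap_rep_swap ρ a b) x))).symm
    have heq {c d : α} (hcd : c ≠ d) : ρ (swap a b) = ρ (swap c d) :=
      rep_swap_eq_of_forall_commute hab hcd fun σ x => by rw [hid, hid]
    intro a' b' c d hnodup
    rw [← heq (c := a') (d := b') (by grind), heq (c := c) (d := d) (by grind)]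
  obtain ⟨v, hv, hv0⟩ := Submodule.exists_mem_ne_zero_of_ne_bot hbot
  by_contra hne
  have hfix (j k : α) (hnodup : [a, b, j, k].Nodup) : ρ (swap j k) v = v :=
    (rep_swap_apply_eq_self_or_rep_swap_eq hnodup hrank hv hv0).resolve_right fun h =>
      hne (disjointSwapsAgree_of_rep_swap_eq hnodup h)
  have hspan := eq_span_singleton_of_finrank_le_one hrank hv hv0
  obtain ⟨u, hu⟩ := exists_isRootFamily hab hv0 (fun x => by
      obtain ⟨r, hr⟩ := Submodule.mem_span_singleton.mp
        (hspan ▸ sub_mem_eigenspace_neg_one (rep_swap_rep_swap ρ a b) x)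
      exact ⟨r, hr.symm⟩)
    (by rw [Module.End.mem_eigenspace_iff.mp hv, neg_one_smul]) hfix
  have hcard : 4 ≤ Fintype.card α := by
    simp only [DisjointSwapsAgree, not_forall] at hne
    obtain ⟨_, _, _, _, hnodup, -⟩ := hne
    exact hnodup.length_le_card
  have := hu.card_le_finrank_add_one hcard
  lia

theorem disjointSwapsAgree_of_finrank_eigenspace_one_le_one [Fintype α]
    (hdim : Module.finrank K V + 2 ≤ Fintype.card α) {a b : α} (hab : a ≠ b)
    (hrank : Module.finrank K (Module.End.eigenspace (ρ (swap a b)) 1) ≤ 1) :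
    DisjointSwapsAgree ρ :=
  disjointSwapsAgree_of_signTwist (disjointSwapsAgree_of_finrank_eigenspace_le_one hdim hab
    (by rwa [eigenspace_signTwist_swap hab]))

end SmallDimension

section Induction

open Equiv

theorem exists_ne_notMem {α : Type*} [Fintype α] {s : Finset α}
    (h : s.card + 2 ≤ Fintype.card α) : ∃ e f, e ≠ f ∧ e ∉ s ∧ f ∉ s := by
  classical
  obtain ⟨e, he, f, hf, hef⟩ := Finset.one_lt_card.mp
    (show 1 < sᶜ.card by rw [Finset.card_compl]; lia)
  exact ⟨e, f, hef, Finset.mem_compl.mp he, Finset.mem_compl.mp hf⟩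

variable {K : Type*} [Field K] [CharZero K]

/-- If both eigenspaces of a transposition have dimension at least `2`, then both have dimension
at most `dim V - 2`, and they are representations of a symmetric group on two letters fewer. -/
theorem disjointSwapsAgree_of_finrank_le (N : ℕ) : ∀ {α V : Type*} [Fintype α] [DecidableEq α]
    [AddCommGroup V] [Module K V] [FiniteDimensional K V] (ρ : Representation K (Perm α) V),
    Fintype.card α = N → Module.finrank K V + 2 ≤ N → DisjointSwapsAgree ρ := by
  induction N using Nat.strong_induction_on with
  | _ N ih =>
  intro α V _ _ _ _ _ ρ hN hdim
  by_contra hne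
  have hneg {e f : α} (hef : e ≠ f) := not_le.mp fun h =>
    hne (disjointSwapsAgree_of_finrank_eigenspace_le_one (hN ▸ hdim) hef h)
  have hpos {e f : α} (hef : e ≠ f) := not_le.mp fun h =>
    hne (disjointSwapsAgree_of_finrank_eigenspace_one_le_one (hN ▸ hdim) hef h)
  refine hne fun a b c d hnodup => ?_
  have hsum (e f : α) :=
    finrank_eigenspace_neg_one_add_finrank_eigenspace_one_le (ρ (swap e f))
  have hN6 : 6 ≤ N := by
    have hab : a ≠ b := by grind
    have := hneg hab
    have := hpos hab
    have := hsum a b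
    lia
  obtain ⟨e, f, hef, he, hf⟩ := exists_ne_notMem (s := [a, b, c, d].toFinset)
    ((Nat.add_le_add_right (List.toFinset_card_le _) 2).trans (hN ▸ hN6))
  rw [List.mem_toFinset] at he hf
  have hcard : Fintype.card {x // x ≠ e ∧ x ≠ f} = N - 2 := by
    have hcompl : Finset.univ.filter (fun x => x ≠ e ∧ x ≠ f) = ({e, f} : Finset α)ᶜ := by
      ext x
      simp only [Finset.mem_filter_univ, Finset.mem_compl, Finset.mem_insert,
        Finset.mem_singleton, not_or]
    rw [Fintype.card_subtype, hcompl, Finset.card_compl, Finset.card_pair hef, hN]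
  refine rep_swap_eq_of_disjointSwapsAgree_swapEigenspace (e := e) (f := f) (by grind)
    fun r hr => ih (N - 2) (by lia) _ hcard ?_
  have := hsum e f
  have := hneg hef
  have := hpos hef
  change Module.finrank K (Module.End.eigenspace (ρ (swap e f)) r) + 2 ≤ N - 2
  rcases hr with rfl | rfl <;> lia

theorem rep_swap_eq_of_finrank_add_two_le {α V : Type*} [Fintype α] [DecidableEq α] [AddCommGroup V]
    [Module K V] [FiniteDimensional K V] {ρ : Representation K (Perm α) V}
    (hcard : 5 ≤ Fintype.card α) (hdim : Module.finrank K V + 2 ≤ Fintype.card α) {a b c d : α}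
    (hab : a ≠ b) (hcd : c ≠ d) : ρ (swap a b) = ρ (swap c d) := by
  have hagree := disjointSwapsAgree_of_finrank_le _ ρ rfl hdim
  by_cases hnodup : [a, b, c, d].Nodup
  · exact hagree hnodup
  have hlt : [a, b, c, d].toFinset.card < 4 := lt_of_le_of_ne (List.toFinset_card_le _)
    fun h => hnodup (Multiset.toFinset_card_eq_card_iff_nodup.mp h)
  obtain ⟨e, f, hef, he, hf⟩ := exists_ne_notMem (s := [a, b, c, d].toFinset) (by lia)
  rw [List.mem_toFinset] at he hf
  rw [hagree (c := e) (d := f) (a := a) (b := b) (by grind),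
    hagree (c := e) (d := f) (a := c) (b := d) (by grind)]

end Induction

/-! ### Schur–Weyl duality -/

section SchurWeyl

theorem exists_linearMap_prod_X_eq {α σ K : Type*} [Fintype α] [CommSemiring K] (F : (α → σ) → K)
    (hF : ∀ (τ : Equiv.Perm α) (w : α → σ), F (w ∘ τ) = F w) :
    ∃ L : MvPolynomial σ K →ₗ[K] K, ∀ w, L (∏ a, MvPolynomial.X (w a)) = F w := by
  classical
  let exponent (w : α → σ) : σ →₀ ℕ := ∑ a, Finsupp.single (w a) 1
  have hexponent (w : α → σ) : Finsupp.toMultiset (exponent w) = Finset.univ.val.map w := by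
    simp only [exponent, Finsupp.toMultiset_sum, Finsupp.toMultiset_single, one_smul]
    rw [← Multiset.sum_map_singleton (Finset.univ.val.map w), Multiset.map_map]
    rfl
  have hfactors : Function.FactorsThrough F exponent := fun w w' h => by
    obtain ⟨τ, rfl⟩ := exists_perm_comp_eq_of_map_univ_eq
      ((hexponent w).symm.trans ((congrArg Finsupp.toMultiset h).trans (hexponent w')))
    exact hF τ w'
  refine ⟨(MvPolynomial.basisMonomials σ K).constr K (Function.extend exponent F 0), fun w => ?_⟩
  have hbasis : ∏ a, MvPolynomial.X (w a) = MvPolynomial.basisMonomials σ K (exponent w) := by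
    rw [MvPolynomial.coe_basisMonomials]
    exact (MvPolynomial.monomial_sum_one _ _).symm
  rw [hbasis, Module.Basis.constr_basis, hfactors.extend_apply]

/-- The matrix `T` commutes with the action of the symmetric group by permutation of the tensor
factors. -/
def Equivariant {n : ℕ} {ι : Type*} (T : Matrix (Fin n → ι) (Fin n → ι) ℂ) : Prop :=
  ∀ (σ : Equiv.Perm (Fin n)) (x y : Fin n → ι), T (x ∘ σ) (y ∘ σ) = T x y

theorem equivariant_tensorPower {n : ℕ} {ι : Type*} (A : Matrix ι ι ℂ) :
    Equivariant (tensorPower n A) :=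
  fun σ x y => Equiv.prod_comp σ fun i => A (x i) (y i)

variable {ι : Type*} [Fintype ι] [DecidableEq ι]

open scoped ComplexOrder in
theorem exists_unitary_mul_diagonal_mul_unitary {A : Matrix ι ι ℂ} (hA : IsUnit A) :
    ∃ W ∈ unitaryGroup ι ℂ, ∃ s : ι → ℂ, ∃ V ∈ unitaryGroup ι ℂ, A = W * diagonal s * V := by
  have hpos : (star A * A).PosDef :=
    PosDef.conjTranspose_mul_self A (mulVec_injective_of_isUnit hA)
  let V := hpos.isHermitian.eigenvectorUnitary
  let s : ι → ℂ := fun i => (√(hpos.isHermitian.eigenvalues i) : ℝ)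
  have hs (i) : s i ≠ 0 :=
    Complex.ofReal_ne_zero.mpr (Real.sqrt_pos.mpr (hpos.eigenvalues_pos i)).ne'
  have hspectral : star (V : Matrix ι ι ℂ) * (star A * A) * V = diagonal s * diagonal s := by
    have hdiag := hpos.isHermitian.conjStarAlgAut_star_eigenvectorUnitary
    rw [Unitary.conjStarAlgAut_star_apply] at hdiag
    refine hdiag.trans
      ((congrArg diagonal (funext fun i => ?_)).trans (diagonal_mul_diagonal ..).symm)
    rw [← Complex.ofReal_mul, Real.mul_self_sqrt (hpos.eigenvalues_pos i).le]
    rfl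
  have hinv : diagonal s * diagonal s⁻¹ = 1 := by
    rw [diagonal_mul_diagonal, ← diagonal_one]
    exact congrArg diagonal (funext fun i => mul_inv_cancel₀ (hs i))
  have hinv' := mul_eq_one_comm.mp hinv
  have hstar : star (diagonal s⁻¹) = diagonal s⁻¹ := by
    rw [star_eq_conjTranspose, diagonal_conjTranspose]
    exact congrArg diagonal (funext fun i => by simp [s])
  refine ⟨A * (V : Matrix ι ι ℂ) * diagonal s⁻¹, mem_unitaryGroup_iff'.mpr ?_, s,
    star V, (star V).2, ?_⟩
  · calc star (A * (V : Matrix ι ι ℂ) * diagonal s⁻¹) * (A * (V : Matrix ι ι ℂ) * diagonal s⁻¹)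
        = diagonal s⁻¹ * (star (V : Matrix ι ι ℂ) * (star A * A) * V) * diagonal s⁻¹ := by
          simp only [star_mul, hstar, Matrix.mul_assoc]
      _ = (diagonal s⁻¹ * diagonal s) * (diagonal s * diagonal s⁻¹) := by
          simp only [hspectral, Matrix.mul_assoc]
      _ = 1 := by rw [hinv, hinv', Matrix.mul_one]
  · rw [Matrix.mul_assoc (A * (V : Matrix ι ι ℂ)), hinv', Matrix.mul_one, Matrix.mul_assoc]
    exact ((congrArg (A * ·) (mem_unitaryGroup_iff.mp V.2)).trans (Matrix.mul_one A)).symm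

variable {n : ℕ} {U : Matrix (Fin n → ι) (Fin n → ι) ℂ}

theorem commute_diagonal_iff {R : Type*} [CommRing R] [NoZeroDivisors R] {A : Matrix ι ι R}
    {t : ι → R} : Commute A (diagonal t) ↔ ∀ i j, A i j ≠ 0 → t i = t j := by
  simp only [commute_iff_eq, ← Matrix.ext_iff, mul_diagonal, diagonal_mul, mul_comm (t _)]
  exact forall₂_congr fun i j => by rw [mul_eq_mul_left_iff, eq_comm, or_iff_not_imp_right]

theorem commute_tensorPower_of_mem_unitaryGroup
    (hU : ∀ g ∈ specialUnitaryGroup ι ℂ, Commute U (tensorPower n g)) {g : Matrix ι ι ℂ}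
    (hg : g ∈ unitaryGroup ι ℂ) : Commute U (tensorPower n g) := by
  obtain hι | hι := isEmpty_or_nonempty ι
  · exact hU g (mem_specialUnitaryGroup_iff.mpr ⟨hg, det_isEmpty⟩)
  let δ : Circle := ⟨g.det, mem_sphere_zero_iff_norm.mpr
    (CStarRing.norm_of_mem_unitary (det_of_mem_unitary hg))⟩
  obtain ⟨z, hz⟩ := exists_circle_pow_eq (Fintype.card_ne_zero (α := ι)) δ
  have hspecial : (z⁻¹ : Circle) • g ∈ specialUnitaryGroup ι ℂ := by
    refine mem_specialUnitaryGroup_iff.mpr ⟨mem_unitaryGroup_iff.mpr ?_, ?_⟩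
    · rw [Circle.smul_def, star_smul, smul_mul_smul_comm, mem_unitaryGroup_iff.mp hg,
        Circle.coe_inv_eq_conj, starRingEnd_apply, star_star, ← starRingEnd_apply, mul_comm,
        Complex.mul_conj, Circle.normSq_coe, Complex.ofReal_one, one_smul]
    · rw [Circle.smul_def, det_smul, ← Circle.coe_pow, inv_pow, hz, Circle.coe_inv]
      exact inv_mul_cancel₀ (Circle.coe_ne_zero δ)
  have hscalar : g = (z : ℂ) • (z⁻¹ : Circle) • g := (smul_inv_smul z g).symm
  rw [hscalar, tensorPower_smul]
  exact (hU _ hspecial).smul_right _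

theorem commute_tensorPower_diagonal
    (hU : ∀ g ∈ unitaryGroup ι ℂ, Commute U (tensorPower n g)) (t : ι → ℂ) :
    Commute U (tensorPower n (diagonal t)) := by
  rw [tensorPower_diagonal, commute_diagonal_iff]
  refine fun x y hne => prod_eq_prod_of_map_univ_eq
    (map_univ_eq_of_forall_prod_eq (fun _ => n + 1) (fun _ => n.succ_ne_zero) ?_ fun ζ _ => ?_) t
  · simp
  · have hζ := hU _ (diagonalUnitary ζ).2
    rw [diagonalUnitary, tensorPower_diagonal, commute_diagonal_iff] at hζ
    apply Circle.coe_injective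
    exact (map_prod Circle.coeHom _ _).trans ((hζ x y hne).trans (map_prod Circle.coeHom _ _).symm)

theorem commute_tensorPower_of_isUnit
    (hU : ∀ g ∈ unitaryGroup ι ℂ, Commute U (tensorPower n g)) {A : Matrix ι ι ℂ}
    (hA : IsUnit A) : Commute U (tensorPower n A) := by
  obtain ⟨W, hW, s, V, hV, rfl⟩ := exists_unitary_mul_diagonal_mul_unitary hA
  rw [tensorPower_mul, tensorPower_mul]
  exact ((hU W hW).mul_right (commute_tensorPower_diagonal hU s)).mul_right (hU V hV)

theorem Equivariant.commute {T : Matrix (Fin n → ι) (Fin n → ι) ℂ} (hT : Equivariant T)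
    (hU : ∀ g ∈ specialUnitaryGroup ι ℂ, Commute U (tensorPower n g)) : Commute U T := by
  obtain ⟨L, hL⟩ := exists_linearMap_prod_X_eq
    (fun w : Fin n → ι × ι => T (fun i => (w i).1) (fun i => (w i).2)) fun σ w =>
      hT σ (fun i => (w i).1) fun i => (w i).2
  ext x z
  have hpoly : ∑ y, U x y • ∏ i, (MvPolynomial.X (y i, z i) : MvPolynomial (ι × ι) ℂ) =
      ∑ y, U y z • ∏ i, (MvPolynomial.X (x i, y i) : MvPolynomial (ι × ι) ℂ) := by
    refine MvPolynomial.eq_of_eval_eq_on_gl fun g => ?_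
    have hg := congrFun₂ (commute_tensorPower_of_isUnit
      (fun g => commute_tensorPower_of_mem_unitaryGroup hU) g.isUnit).eq x z
    simpa only [mul_apply, tensorPower, of_apply, map_sum, MvPolynomial.smul_eval, map_prod,
      MvPolynomial.eval_X, mul_comm (U _ z)] using hg
  simpa only [map_sum, map_smul, hL, smul_eq_mul, mul_apply, mul_comm (U _ z)]
    using congrArg L hpoly

end SchurWeyl

section GroupAlgebra

open scoped MonoidAlgebra

theorem isSimpleModule_asSubmodule {K G V : Type*} [Field K] [Group G] [AddCommGroup V]
    [Module K V] {ρ : Representation K G V} (W : Subrepresentation ρ)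
    (hW : W.toRepresentation.IsIrreducible) :
    IsSimpleModule K[G] (Subrepresentation.asSubmodule W) := by
  let inclusion := Representation.IntertwiningMap.equivLinearMapAsModule W.toRepresentation ρ
    ⟨W.toSubmodule.subtype, fun _ => rfl⟩
  have hrange : LinearMap.range inclusion = Subrepresentation.asSubmodule W :=
    SetLike.coe_injective Subtype.range_coe
  have := (Representation.irreducible_iff_isSimpleModule_asModule _).mp hW
  rw [← hrange]
  exact IsSimpleModule.congr (LinearEquiv.ofInjective inclusion Subtype.val_injective).symm

variable {n d : ℕ}

instance permModule : Module ℂ[Equiv.Perm (Fin n)] (Config n d → ℂ) :=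
  inferInstanceAs (Module ℂ[Equiv.Perm (Fin n)] (permRep n d).asModule)

instance isScalarTower_permModule : IsScalarTower ℂ ℂ[Equiv.Perm (Fin n)] (Config n d → ℂ) :=
  inferInstanceAs (IsScalarTower ℂ ℂ[Equiv.Perm (Fin n)] (permRep n d).asModule)

theorem single_smul_apply (σ : Equiv.Perm (Fin n)) (a : ℂ) (v : Config n d → ℂ) (x : Config n d) :
    ((MonoidAlgebra.single σ a : ℂ[Equiv.Perm (Fin n)]) • v) x = a * v (x ∘ σ) :=
  congrFun ((permRep n d).single_smul a σ v) x

theorem isSelfAdjointAction_perm : IsSelfAdjointAction (ι := Config n d) ℂ[Equiv.Perm (Fin n)] := by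
  intro r
  induction r using MonoidAlgebra.induction_linear with
  | zero =>
    exact ⟨0, fun v w => by simp only [zero_smul, star_zero, dotProduct_zero, zero_dotProduct]⟩
  | add r s hr hs =>
    obtain ⟨r', hr'⟩ := hr
    obtain ⟨s', hs'⟩ := hs
    refine ⟨r' + s', fun v w => ?_⟩
    rw [add_smul, add_smul, dotProduct_add, star_add, add_dotProduct, hr', hs']
  | single σ a =>
    refine ⟨MonoidAlgebra.single σ⁻¹ (star a), fun v w => ?_⟩
    simp only [dotProduct, Pi.star_apply, single_smul_apply, star_mul', star_star]
    refine Fintype.sum_equiv (σ⁻¹.arrowCongr (Equiv.refl _)) _ _ fun x => ?_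
    have hx : (σ⁻¹.arrowCongr (Equiv.refl (Fin d))) x = x ∘ σ := rfl
    rw [hx, Function.comp_assoc, ← Equiv.Perm.coe_mul, mul_inv_cancel, Equiv.Perm.coe_one,
      Function.comp_id]
    ring

theorem equivariant_iff_exists_linearMap {T : Matrix (Config n d) (Config n d) ℂ} :
    Equivariant T ↔
      ∃ f : Module.End ℂ[Equiv.Perm (Fin n)] (Config n d → ℂ), ∀ v, f v = T *ᵥ v := by
  constructor
  · intro hT
    refine ⟨Representation.IntertwiningMap.equivLinearMapAsModule (permRep n d) (permRep n d)
      ⟨toLin' T, fun σ => LinearMap.ext fun v => funext fun x => ?_⟩, fun v => rfl⟩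
    change ∑ y, T x y * v (y ∘ σ) = ∑ y, T (x ∘ σ) y * v y
    refine Fintype.sum_equiv (σ⁻¹.arrowCongr (Equiv.refl _)) _ _ fun y => ?_
    exact congrArg (· * v (y ∘ σ)) (hT σ x y).symm
  · rintro ⟨f, hf⟩ σ x y
    have hsingle : (MonoidAlgebra.single σ 1 : ℂ[Equiv.Perm (Fin n)]) •
        (Pi.single (y ∘ σ) 1 : Config n d → ℂ) = Pi.single y 1 := by
      ext z
      have hσ : z ∘ σ = y ∘ σ ↔ z = y := σ.surjective.injective_comp_right.eq_iff
      rw [single_smul_apply, one_mul, Pi.single_apply, Pi.single_apply, if_congr hσ rfl rfl]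
    have hcomm := congrFun (f.map_smul (MonoidAlgebra.single σ 1) (Pi.single (y ∘ σ) 1)) x
    rw [hsingle, single_smul_apply, one_mul, hf, hf, mulVec_single_one, mulVec_single_one] at hcomm
    exact hcomm.symm

theorem mem_symmetricUnitaries_iff {U : unitaryGroup (Config n d) ℂ} :
    U ∈ symmetricUnitaries n d ↔
      MemBicommutant ℂ[Equiv.Perm (Fin n)] (U : Matrix (Config n d) (Config n d) ℂ) := by
  constructor
  · intro hU f v
    let T := LinearMap.toMatrix' (f.restrictScalars ℂ)
    have hT (v : Config n d → ℂ) : f v = T *ᵥ v :=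
      (LinearMap.toMatrix'_mulVec (f.restrictScalars ℂ) v).symm
    have hcomm := (equivariant_iff_exists_linearMap.mpr ⟨f, hT⟩).commute hU
    rw [hT, hT, mulVec_mulVec, mulVec_mulVec, hcomm.eq]
  · intro hU g _
    obtain ⟨f, hf⟩ := equivariant_iff_exists_linearMap.mp (equivariant_tensorPower (n := n) g)
    refine ext_of_mulVec_single fun x => ?_
    rw [← mulVec_mulVec, ← mulVec_mulVec, ← hf, ← hf, hU]

theorem mem_specialSymmetricUnitaries_of_memBicommutant {U : unitaryGroup (Config n d) ℂ}
    (hU : MemBicommutant ℂ[Equiv.Perm (Fin n)] (U : Matrix (Config n d) (Config n d) ℂ))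
    (hdet : ∀ W : Submodule ℂ[Equiv.Perm (Fin n)] (Config n d → ℂ),
      IsSimpleModule ℂ[Equiv.Perm (Fin n)] W →
        HasDetOneOn (W.restrictScalars ℂ) (U : Matrix (Config n d) (Config n d) ℂ)) :
    U ∈ specialSymmetricUnitaries n d :=
  ⟨mem_symmetricUnitaries_iff.mpr hU, fun W hW =>
    hdet (Subrepresentation.asSubmodule W) (isSimpleModule_asSubmodule W hW)⟩

end GroupAlgebra

section SmallSubmodules

open Equiv
open scoped MonoidAlgebra

theorem nonempty_linearEquiv_of_smul_eq_zero_iff {R M N : Type*} [Ring R] [AddCommGroup M]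
    [Module R M] [IsSimpleModule R M] [AddCommGroup N] [Module R N] [IsSimpleModule R N] {v : M}
    {w : N} (hv : v ≠ 0) (hw : w ≠ 0) (h : ∀ r : R, r • v = 0 ↔ r • w = 0) :
    Nonempty (M ≃ₗ[R] N) :=
  have hker : LinearMap.ker (LinearMap.toSpanSingleton R M v) =
      LinearMap.ker (LinearMap.toSpanSingleton R N w) := Submodule.ext h
  ⟨((LinearMap.toSpanSingleton R M v).quotKerEquivOfSurjective
      (IsSimpleModule.toSpanSingleton_surjective R hv)).symm ≪≫ₗ
    Submodule.quotEquivOfEq _ _ hker ≪≫ₗ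
    (LinearMap.toSpanSingleton R N w).quotKerEquivOfSurjective
      (IsSimpleModule.toSpanSingleton_surjective R hw)⟩

variable {n d : ℕ}

theorem exists_smul_eq_smul_of_permRep_apply_eq_self (r : ℂ[Perm (Fin n)]) :
    ∃ c : ℂ, ∀ v : Config n d → ℂ, (∀ σ, permRep n d σ v = v) → r • v = c • v := by
  induction r using MonoidAlgebra.induction_linear with
  | zero => exact ⟨0, fun v _ => by rw [zero_smul, zero_smul]⟩
  | add r s hr hs =>
    obtain ⟨a, ha⟩ := hr
    obtain ⟨b, hb⟩ := hs
    exact ⟨a + b, fun v hv => by rw [add_smul, add_smul, ha v hv, hb v hv]⟩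
  | single σ a =>
    refine ⟨a, fun v hv => funext fun x => ?_⟩
    rw [single_smul_apply]
    exact congrArg (a * ·) (congrFun (hv σ) x)

theorem permRep_swap_apply {i j : Fin n} {x : Config n d} (hx : x i = x j) (w : Config n d → ℂ) :
    permRep n d (swap i j) w x = w x := by
  change w (x ∘ swap i j) = w x
  congr 1
  funext l
  rw [Function.comp_apply, apply_swap_eq_self hx]

/-- As `d < n`, every configuration has a repeated letter, and the transposition of two places
which carry the same letter does not move it. -/
theorem permRep_apply_eq_self_of_forall_swap_eq (hd : d < n) (W : Subrepresentation (permRep n d))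
    (hswap : ∀ a b i j, a ≠ b → i ≠ j →
      W.toRepresentation (swap a b) = W.toRepresentation (swap i j))
    (σ : Perm (Fin n)) {w : Config n d → ℂ} (hw : w ∈ W.toSubmodule) : permRep n d σ w = w := by
  have hfix {a b : Fin n} (hab : a ≠ b) : permRep n d (swap a b) w = w := by
    funext x
    obtain ⟨i, j, hij, hx⟩ := Fintype.exists_ne_map_eq_of_card_lt x (by simpa using hd)
    have heq : permRep n d (swap a b) w = permRep n d (swap i j) w :=
      congrArg Subtype.val (LinearMap.congr_fun (hswap a b i j hab hij) ⟨w, hw⟩)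
    rw [heq, permRep_swap_apply hx]
  induction σ using Perm.swap_induction_on with
  | one => rw [map_one, Module.End.one_apply]
  | swap_mul τ x y hxy ih => rw [map_mul, Module.End.mul_apply, ih, hfix hxy]

theorem permRep_apply_eq_self_of_finrank_le {k : ℕ} (hk : k + 1 < n) (hd : d < n)
    (hn : ¬(n = 4 ∧ k = 2)) (W : Subrepresentation (permRep n d))
    (hW : Module.finrank ℂ W.toSubmodule ≤ k) (σ : Perm (Fin n)) {w : Config n d → ℂ}
    (hw : w ∈ W.toSubmodule) : permRep n d σ w = w := by
  refine permRep_apply_eq_self_of_forall_swap_eq hd W (fun a b i j hab hij => ?_) σ hw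
  by_cases hk1 : k ≤ 1
  · exact rep_swap_eq_of_finrank_le_one (hW.trans hk1) hab hij
  · refine rep_swap_eq_of_finrank_add_two_le ?_ ?_ hab hij <;> rw [Fintype.card_fin] <;> lia

theorem nonempty_linearEquiv_of_finrank_le {k : ℕ} (hk : k + 1 < n) (hd : 1 ≤ k → d < n)
    (hn : ¬(n = 4 ∧ k = 2)) {S T : Submodule ℂ[Perm (Fin n)] (Config n d → ℂ)}
    (hS : IsSimpleModule ℂ[Perm (Fin n)] S) (hT : IsSimpleModule ℂ[Perm (Fin n)] T)
    (hSk : Module.finrank ℂ S ≤ k) (hTk : Module.finrank ℂ T ≤ k) :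
    Nonempty (S ≃ₗ[ℂ[Perm (Fin n)]] T) := by
  have := hS.nontrivial
  have := hT.nontrivial
  have : Module.Finite ℂ S := inferInstanceAs (Module.Finite ℂ (S.restrictScalars ℂ))
  have hdn : d < n := hd (Module.finrank_pos.trans_le hSk)
  have htriv {W : Submodule ℂ[Perm (Fin n)] (Config n d → ℂ)} (hW : Module.finrank ℂ W ≤ k)
      (w : W) (σ : Perm (Fin n)) : permRep n d σ w = w :=
    permRep_apply_eq_self_of_finrank_le hk hdn hn (Subrepresentation.ofSubmodule' W) hW σ w.2
  obtain ⟨v, hv⟩ := exists_ne (0 : S)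
  obtain ⟨w, hw⟩ := exists_ne (0 : T)
  refine nonempty_linearEquiv_of_smul_eq_zero_iff hv hw fun r => ?_
  obtain ⟨c, hc⟩ := exists_smul_eq_smul_of_permRep_apply_eq_self (d := d) r
  have hrv : r • v = c • v := Subtype.ext (hc v (htriv hSk v))
  have hrw : r • w = c • w := Subtype.ext (hc w (htriv hTk w))
  rw [hrv, hrw, smul_eq_zero_iff_left hv, smul_eq_zero_iff_left hw]

end SmallSubmodules

end SymDesign

end

theorem mainTheorem3 (n d k : ℕ) (hk : k + 1 < n) (hd : 1 ≤ k → d < n)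
    (hn : ¬ (n = 4 ∧ k = 2)) :
    SymDesign.momentOperator k (SymDesign.specialSymmetricUnitaries n d) =
      SymDesign.momentOperator k (SymDesign.symmetricUnitaries n d) :=
  SymDesign.momentOperator_eq_of_le k (fun _ hU => hU.1) fun _ hU =>
    SymDesign.isSelfAdjointAction_perm.momentOperator_mul_of_memBicommutant
      (fun _ _ => SymDesign.nonempty_linearEquiv_of_finrank_le hk hd hn)
      (fun _ => SymDesign.mem_specialSymmetricUnitaries_of_memBicommutant)
      (SymDesign.mem_symmetricUnitaries_iff.mp hU)
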